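/- **Theorem.** Let $G$ be a finite graph with $n$ vertices and maximum degree $\Delta$, and let its vertex set be partitioned into blocks $V_1, \dots, V_k$ of size $b$ each (edges inside blocks are allowed). A *strong coloring* is a proper vertex-coloring of $G$ with $b$ colors in which every block receives all $b$ colors. If $b \ge 5\Delta$, then $G$ has a strong coloring, and one can be found by a randomized algorithm in expected time $O(n^2\Delta^2)$. Precisely: there are one program of a randomized random-access machine and one absolute constant $C$ such that for every such graph and partition with $b \ge 5\Delta$, given by $n$, $k$, $b$, the adjacency lists (in any order) of the vertices $0, \dots, n-1$ and the block index of every vertex, the program's output whenever it halts is a strong coloring, and its expected number of steps is at most $C \cdot \max(n,1)^2 \cdot \max(\Delta,1)^2$; in particular it halts with probability one. The machine has registers and indirectly addressed arrays of natural numbers, and each instruction (constant, copy, increment, decrement, load, store, drawing a uniformly random element of $\{0,\dots,y-1\}$ for a stored number $y$, comparison and branching) costs one step. -/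

import Mathlib

/-- A vertex colouring `col` with `b` colours is a strong colouring of `G` with respect to the
blocks `{v | blk v = i}` if it is proper and every block receives all `b` colours
(hence, for blocks of size `b`, each colour exactly once). -/
def IsStrongColoring {V ι : Type*} (G : SimpleGraph V) (blk : V → ι) {b : ℕ}
    (col : V → Fin b) : Prop :=
  (∀ u v, G.Adj u v → col u ≠ col v) ∧ ∀ (i : ι) (c : Fin b), ∃ v, blk v = i ∧ col v = c

/-! ### A randomized random-access machine with unit cost

The memory consists of registers and of arrays, all holding natural numbers and indexed by `ℕ`.
A program names its registers and arrays by numerals, so it uses only finitely many of them; the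
entries of an array are addressed indirectly, through the content of a register.
The only arithmetic is increment and decrement: after `t` steps every number in memory is at most
`t` plus the largest number in the input or in the program text, so that charging one unit per
instruction is honest. -/

namespace RAM

/-- Structured programs. -/
inductive Prog : Type
  /-- `x := c` for a fixed numeral `c` -/
  | const (x c : ℕ)
  /-- `x := y` -/
  | copy (x y : ℕ)
  /-- `x := x + 1` -/
  | incr (x : ℕ)
  /-- `x := x - 1` (and `0` stays `0`) -/
  | decr (x : ℕ)
  /-- `x := a[y]` -/
  | load (x a y : ℕ)
  /-- `a[x] := y` -/
  | store (a x y : ℕ)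
  /-- `x :=` a fresh uniformly random element of `{0, …, y - 1}` (`0` if `y = 0`) -/
  | rand (x y : ℕ)
  /-- `p; q` -/
  | seq (p q : Prog)
  /-- `if x < y then p else q` -/
  | ite (x y : ℕ) (p q : Prog)
  /-- `while x < y do p` -/
  | loop (x y : ℕ) (p : Prog)

/-- The contents of the memory: `reg x` is the content of register `x` and `arr a i` is the entry
of array `a` at index `i`. -/
structure Memory : Type where
  reg : ℕ → ℕ
  arr : ℕ → ℕ → ℕ

/-- Write `v` to register `x`. -/
def Memory.setReg (m : Memory) (x v : ℕ) : Memory :=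
  { m with reg := Function.update m.reg x v }

/-- Write `v` to entry `i` of array `a`. -/
def Memory.setArr (m : Memory) (a i v : ℕ) : Memory :=
  { m with arr := Function.update m.arr a (Function.update (m.arr a) i v) }

/-- A configuration: the programs still to be executed, in this order, and the memory. -/
structure Config : Type where
  todo : List Prog
  mem : Memory

/-- The machine has halted when nothing is left to be executed. -/
def Config.Halted (c : Config) : Prop := c.todo = []

/-- The uniform distribution on `{0, …, m - 1}` (the point mass at `0` if `m = 0`). -/
noncomputable def uniformBelow (m : ℕ) : PMF ℕ :=
  PMF.uniformOfFinset (Finset.range (max m 1)) ⟨0, by simp⟩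

/-- One step of the machine, as a distribution on the next configurations.
A halted configuration does not change any more. -/
noncomputable def step : Config → PMF Config
  | ⟨[], m⟩ => PMF.pure ⟨[], m⟩
  | ⟨.const x c :: K, m⟩ => PMF.pure ⟨K, m.setReg x c⟩
  | ⟨.copy x y :: K, m⟩ => PMF.pure ⟨K, m.setReg x (m.reg y)⟩
  | ⟨.incr x :: K, m⟩ => PMF.pure ⟨K, m.setReg x (m.reg x + 1)⟩
  | ⟨.decr x :: K, m⟩ => PMF.pure ⟨K, m.setReg x (m.reg x - 1)⟩
  | ⟨.load x a y :: K, m⟩ => PMF.pure ⟨K, m.setReg x (m.arr a (m.reg y))⟩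
  | ⟨.store a x y :: K, m⟩ => PMF.pure ⟨K, m.setArr a (m.reg x) (m.reg y)⟩
  | ⟨.rand x y :: K, m⟩ => (uniformBelow (m.reg y)).map fun r => ⟨K, m.setReg x r⟩
  | ⟨.seq p q :: K, m⟩ => PMF.pure ⟨p :: q :: K, m⟩
  | ⟨.ite x y p q :: K, m⟩ => PMF.pure (if m.reg x < m.reg y then ⟨p :: K, m⟩ else ⟨q :: K, m⟩)
  | ⟨.loop x y p :: K, m⟩ =>
      PMF.pure (if m.reg x < m.reg y then ⟨p :: .loop x y p :: K, m⟩ else ⟨K, m⟩)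

/-- The distribution of the configuration after `t` steps from the configuration `c`. -/
noncomputable def stepDist (c : Config) : ℕ → PMF Config
  | 0 => PMF.pure c
  | t + 1 => (stepDist c t).bind step

/-- The distribution of the configuration after `t` steps of the program `p` on the initial
memory `m`. -/
noncomputable def run (p : Prog) (m : Memory) (t : ℕ) : PMF Config := stepDist ⟨[p], m⟩ t

/-- The expected number of steps `E[T] = ∑_{t ≥ 0} P(T > t)` until the machine halts
(infinite if it fails to halt with positive probability). -/
noncomputable def expectedTime (p : Prog) (m : Memory) : ENNReal :=
  ∑' t, (run p m t).toOuterMeasure {c | ¬ c.Halted}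

end RAM

/-- `L` is an adjacency-list representation of `G`: `L v` lists the neighbours of `v`, without
repetition and in any order. -/
def IsAdjList {V : Type*} (G : SimpleGraph V) (L : V → List V) : Prop :=
  ∀ v, (L v).Nodup ∧ ∀ u, u ∈ L v ↔ G.Adj v u

/-- The initial memory for a graph on the vertices `0, …, n - 1` with adjacency lists `L` and
with blocks `0, …, k - 1` of size `b`. Registers `0, 1, 2` hold `n, k, b`.
Array `1` is the concatenation of the adjacency lists of `0, 1, …, n - 1`, array `0` holds at `v`
the position in array `1` where the list of `v` begins (and at `n` the total length), and
array `2` holds at `v` the block of `v`. All other cells are zero. -/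
def inputMemory {n k : ℕ} (b : ℕ) (L : Fin n → List (Fin n)) (blk : Fin n → Fin k) :
    RAM.Memory where
  reg
    | 0 => n
    | 1 => k
    | 2 => b
    | _ => 0
  arr
    | 0 => fun v => (((List.finRange n).take v).map fun u => (L u).length).sum
    | 1 => fun p => (((List.finRange n).flatMap L).map Fin.val).getD p 0
    | 2 => fun v => if h : v < n then (blk ⟨v, h⟩ : ℕ) else 0
    | _ => fun _ => 0

/-- The colouring `col` is stored in array `3` of the memory `m`. -/
def HoldsColoring {n b : ℕ} (m : RAM.Memory) (col : Fin n → Fin b) : Prop :=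
  ∀ v : Fin n, m.arr 3 v = col v

/-! The vertices are treated in the order 0, …, n-1, keeping a colouring that is bijective on every
block and proper on the vertices already treated (`IsPartialStrong`). Let t be the next vertex, c
its colour, and x i the vertex of colour c in block i. In every block the colours of x i and of some
vertex y i are exchanged, where y is an independent transversal with y (blk t) = t such that, in the
other blocks, no neighbour of x i has the colour of y i. The new colour class c is then independent,
and each displaced x i receives a harmless colour (`IsPartialStrong.exchange`). As colours within a
block are distinct, the neighbours of x i exclude at most Δ vertices of block i, so b ≥ 5Δ leaves at
least 4Δ candidates for y i (`IsCandList.length_eq`).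

The transversal is found by a random walk. It keeps an independent partial transversal and a stack
of the empty blocks, with the block of t at the bottom. The top block draws a candidate. If a chosen
vertex is adjacent to it, the draw is discarded, one such chosen vertex is deleted and its block is
pushed; otherwise the draw is chosen and the top block is popped.

For the analysis, the survival probability is summed over all choices of vertices outside a fixed
stack. A round can be undone: a push is determined by the resulting choice together with the edge
that caused it. This gives a linear recursion (`TransversalWalk.total_succ_le`) in which pushing i
above j has as coefficient the number of edges between their candidates. There are at most 4Δ·Δ
edges at j, and a potential with factor 1/(2Δ) per level of the stack is exactly critical: 1 + 4Δ²x²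
= 4Δx. The gain comes from the block p just below j. If j and p are joined, at least one edge at j
leads to p and cannot cause a push. If they are not joined, that level carries a slightly larger
factor y, while every pushed block is joined to the one below it and carries the smaller x. Hence
the sums decay by 1 - 1/(16Δ²) per round (`TransversalWalk.total_le`). From the full stack the
initial factor is 2^(k-1), which is used up after 16Δ²(k-1) rounds, so 16Δ²k rounds are expected in
total (`TransversalWalk.sum_surv_le`).

A round takes O(Δ) steps and 5Δk ≤ n, so a phase takes O(nΔ²) steps, and there are n phases. Both
claims about the program follow from one bound on a cost with a terminal penalty, infinite on wrong
outputs (`RAM.strongColoring_correct`). Existence follows because a program of finite expected time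
can halt. -/

namespace RAM

/-! ### Expectations and the truncated cost of a run -/

open scoped ENNReal

/-- The expectation of `f` under the distribution `p`. -/
noncomputable def expect {α : Type*} (p : PMF α) (f : α → ℝ≥0∞) : ℝ≥0∞ := ∑' a, p a * f a

theorem expect_pure {α : Type*} (a : α) (f : α → ℝ≥0∞) : expect (PMF.pure a) f = f a := by
  unfold expect
  rw [tsum_eq_single a]
  · simp
  · intro b hb
    simp [PMF.pure_apply, hb]

theorem expect_bind {α β : Type*} (p : PMF α) (q : α → PMF β) (f : β → ℝ≥0∞) :
    expect (p.bind q) f = expect p fun a => expect (q a) f := by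
  unfold expect
  simp_rw [PMF.bind_apply, ← ENNReal.tsum_mul_right, ← ENNReal.tsum_mul_left]
  rw [ENNReal.tsum_comm]
  simp_rw [mul_assoc]

theorem expect_map {α β : Type*} (p : PMF α) (q : α → β) (f : β → ℝ≥0∞) :
    expect (p.map q) f = expect p fun a => f (q a) := by
  rw [PMF.map, expect_bind]
  simp [expect_pure]

theorem expect_mono {α : Type*} (p : PMF α) {f g : α → ℝ≥0∞} (h : ∀ a, f a ≤ g a) :
    expect p f ≤ expect p g :=
  ENNReal.tsum_le_tsum fun a => by gcongr; exact h a

theorem expect_add {α : Type*} (p : PMF α) (f g : α → ℝ≥0∞) :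
    expect p (fun a => f a + g a) = expect p f + expect p g := by
  unfold expect
  simp_rw [mul_add]
  exact ENNReal.tsum_add

theorem expect_sum {α ι : Type*} (p : PMF α) (s : Finset ι) (f : ι → α → ℝ≥0∞) :
    expect p (fun a => ∑ i ∈ s, f i a) = ∑ i ∈ s, expect p (f i) := by
  classical
  induction s using Finset.induction_on with
  | empty => simp [expect]
  | insert i s hi ih => simp_rw [Finset.sum_insert hi, expect_add, ih]

theorem le_expect_of_mem_support {α : Type*} {p : PMF α} {f : α → ℝ≥0∞} {a : α}
    (ha : a ∈ p.support) (hf : f a = ⊤) : expect p f = ⊤ := by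
  refine ENNReal.tsum_eq_top_of_eq_top ⟨a, ?_⟩
  rw [hf]
  exact ENNReal.mul_top ((PMF.mem_support_iff _ _).1 ha)

theorem toOuterMeasure_eq_expect {α : Type*} (p : PMF α) (s : Set α) :
    p.toOuterMeasure s = expect p (s.indicator 1) := by
  rw [PMF.toOuterMeasure_apply]
  refine tsum_congr fun a => ?_
  by_cases h : a ∈ s <;> simp [h]

theorem expect_uniformBelow (m : ℕ) (hm : 0 < m) (f : ℕ → ℝ≥0∞) :
    expect (uniformBelow m) f = (m : ℝ≥0∞)⁻¹ * ∑ r ∈ Finset.range m, f r := by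
  have hu : ∀ r, uniformBelow m r = if r ∈ Finset.range m then (m : ℝ≥0∞)⁻¹ else 0 := by
    intro r
    have hmax : max m 1 = m := by omega
    refine (PMF.uniformOfFinset_apply _ _).trans ?_
    rw [hmax, Finset.card_range]
    congr
  unfold expect
  rw [tsum_eq_sum (s := Finset.range m), Finset.mul_sum]
  · refine Finset.sum_congr rfl fun r hr => ?_
    rw [hu, if_pos hr]
  · intro r hr
    rw [hu, if_neg hr, zero_mul]

/-- The expected number of steps among the first `T`, plus the terminal cost `g` of the memory
upon halting if this is reached within that time. -/
noncomputable def cost (g : Memory → ℝ≥0∞) : ℕ → Config → ℝ≥0∞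
  | 0, _ => 0
  | _ + 1, ⟨[], m⟩ => g m
  | T + 1, ⟨p :: K, m⟩ => 1 + expect (step ⟨p :: K, m⟩) (cost g T)

theorem cost_mono_succ (g : Memory → ℝ≥0∞) (T : ℕ) (c : Config) : cost g T c ≤ cost g (T + 1) c := by
  induction T generalizing c with
  | zero => simp [cost]
  | succ T ih =>
    obtain ⟨_ | ⟨p, K⟩, m⟩ := c
    · simp [cost]
    · rw [cost, cost]
      gcongr
      exact expect_mono _ ih

/-- By monotonicity in `T` the step taken need not be deducted from the time horizon, so all later
rules can use one fixed `T`. -/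
theorem cost_cons_le {g : Memory → ℝ≥0∞} {T : ℕ} {p : Prog} {K : List Prog} {m : Memory} :
    cost g T ⟨p :: K, m⟩ ≤ 1 + expect (step ⟨p :: K, m⟩) (cost g T) := by
  cases T with
  | zero => simp [cost]
  | succ T =>
    rw [cost]
    gcongr
    exact expect_mono _ (cost_mono_succ g T)

theorem cost_le_of_step {g : Memory → ℝ≥0∞} {T : ℕ} {p : Prog} {K : List Prog} {m : Memory}
    {c : Config} (h : step ⟨p :: K, m⟩ = PMF.pure c) :
    cost g T ⟨p :: K, m⟩ ≤ 1 + cost g T c := by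
  have := cost_cons_le (g := g) (T := T) (p := p) (K := K) (m := m)
  rwa [h, expect_pure] at this

theorem stepDist_succ' (c : Config) (t : ℕ) :
    stepDist c (t + 1) = (step c).bind fun c' => stepDist c' t := by
  induction t with
  | zero => simp [stepDist]
  | succ t ih =>
    rw [stepDist, ih, PMF.bind_bind]
    rfl

theorem stepDist_halted (m : Memory) (t : ℕ) : stepDist ⟨[], m⟩ t = PMF.pure ⟨[], m⟩ := by
  induction t with
  | zero => rfl
  | succ t ih => rw [stepDist, ih, PMF.pure_bind]; rfl

theorem sum_not_halted_le_cost (g : Memory → ℝ≥0∞) (T : ℕ) (c : Config) :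
    ∑ t ∈ Finset.range T, (stepDist c t).toOuterMeasure {c | ¬ c.Halted} ≤ cost g T c := by
  induction T generalizing c with
  | zero => simp
  | succ T ih =>
    obtain ⟨_ | ⟨p, K⟩, m⟩ := c
    · refine le_of_eq_of_le (Finset.sum_eq_zero fun t _ => ?_) zero_le
      rw [stepDist_halted, toOuterMeasure_eq_expect, expect_pure]
      simp [Config.Halted]
    · rw [Finset.sum_range_succ', cost, add_comm]
      gcongr
      · rw [toOuterMeasure_eq_expect, stepDist, expect_pure]
        exact Set.indicator_le_self' (by simp) _
      · simp_rw [stepDist_succ', toOuterMeasure_eq_expect, expect_bind, ← toOuterMeasure_eq_expect,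
          ← expect_sum]
        exact expect_mono _ ih

theorem expectedTime_le {p : Prog} {m : Memory} {B : ℝ≥0∞} (g : Memory → ℝ≥0∞)
    (h : ∀ T, cost g T ⟨[p], m⟩ ≤ B) : expectedTime p m ≤ B := by
  unfold expectedTime
  rw [ENNReal.tsum_eq_iSup_nat]
  exact iSup_le fun T => (sum_not_halted_le_cost g T _).trans (h T)

/-- A finite bound on the cost thus shows that no reachable halting memory has infinite terminal
cost: a time bound also yields correctness. -/
theorem cost_eq_top_of_mem_support {g : Memory → ℝ≥0∞} {t : ℕ} {c c' : Config}
    (hc : c' ∈ (stepDist c t).support) (hh : c'.Halted) (hg : g c'.mem = ⊤) :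
    cost g (t + 1) c = ⊤ := by
  induction t generalizing c with
  | zero =>
    rw [stepDist, PMF.support_pure, Set.mem_singleton_iff] at hc
    subst hc
    obtain ⟨l, m⟩ := c'
    obtain rfl : l = [] := hh
    exact hg
  | succ t ih =>
    obtain ⟨_ | ⟨p, K⟩, m⟩ := c
    · rw [stepDist_halted, PMF.support_pure, Set.mem_singleton_iff] at hc
      subst hc
      exact hg
    · rw [stepDist_succ', PMF.mem_support_bind_iff] at hc
      obtain ⟨d, hd, hd'⟩ := hc
      rw [cost, le_expect_of_mem_support hd (ih hd'), add_top]

/-- `Ht m p τ Q`: started in the memory `m`, the program `p` takes at most `τ` steps in expectation,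
and it ends, if it ends, in a memory that satisfies `Q`. -/
def Ht (m : Memory) (p : Prog) (τ : ℕ) (Q : Memory → Prop) : Prop :=
  ∀ (g : Memory → ℝ≥0∞) (K : List Prog) (B : ℝ≥0∞) (T : ℕ),
    (∀ m', Q m' → cost g T ⟨K, m'⟩ ≤ B) → cost g T ⟨p :: K, m⟩ ≤ τ + B

/-! ### Rules for bounding expected running times -/

namespace Ht

variable {m : Memory} {p q : Prog} {τ τ' : ℕ} {Q R : Memory → Prop}

theorem of_step {m' : Memory} (h : ∀ K, step ⟨p :: K, m⟩ = PMF.pure ⟨K, m'⟩) (hQ : Q m') :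
    Ht m p 1 Q := by
  intro g K B T hB
  refine (cost_le_of_step (h K)).trans ?_
  rw [Nat.cast_one]
  gcongr
  exact hB _ hQ

theorem mono (h : Ht m p τ Q) (hτ : τ ≤ τ') (hQ : ∀ m', Q m' → R m') : Ht m p τ' R := by
  intro g K B T hB
  refine (h g K B T fun m' hm' => hB _ (hQ _ hm')).trans ?_
  gcongr

theorem weaken (h : Ht m p τ Q) (hτ : τ ≤ τ') : Ht m p τ' Q := h.mono hτ fun _ => id

theorem seq (hp : Ht m p τ R) (hq : ∀ m', R m' → Ht m' q τ' Q) :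
    Ht m (.seq p q) (1 + τ + τ') Q := by
  intro g K B T hB
  refine (cost_le_of_step (c := ⟨p :: q :: K, m⟩) rfl).trans ?_
  push_cast
  rw [add_assoc, add_assoc]
  gcongr
  exact hp g (q :: K) _ T fun m' hm' => hq m' hm' g K B T hB

theorem const {x c : ℕ} (h : Q (m.setReg x c)) : Ht m (.const x c) 1 Q := of_step (fun _ => rfl) h
theorem copy {x y : ℕ} (h : Q (m.setReg x (m.reg y))) : Ht m (.copy x y) 1 Q :=
  of_step (fun _ => rfl) h
theorem incr {x : ℕ} (h : Q (m.setReg x (m.reg x + 1))) : Ht m (.incr x) 1 Q :=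
  of_step (fun _ => rfl) h
theorem decr {x : ℕ} (h : Q (m.setReg x (m.reg x - 1))) : Ht m (.decr x) 1 Q :=
  of_step (fun _ => rfl) h
theorem load {x a y : ℕ} (h : Q (m.setReg x (m.arr a (m.reg y)))) : Ht m (.load x a y) 1 Q :=
  of_step (fun _ => rfl) h
theorem store {a x y : ℕ} (h : Q (m.setArr a (m.reg x) (m.reg y))) : Ht m (.store a x y) 1 Q :=
  of_step (fun _ => rfl) h

theorem seq_of_step {m' : Memory} (h : ∀ K, step ⟨p :: K, m⟩ = PMF.pure ⟨K, m'⟩)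
    (hq : Ht m' q τ Q) : Ht m (.seq p q) (τ + 2) Q :=
  (seq (R := fun m'' => m'' = m') (of_step h rfl) (by rintro _ rfl; exact hq)).weaken (by omega)

theorem const_seq {x c : ℕ} (h : Ht (m.setReg x c) q τ Q) : Ht m (.seq (.const x c) q) (τ + 2) Q :=
  seq_of_step (fun _ => rfl) h
theorem copy_seq {x y : ℕ} (h : Ht (m.setReg x (m.reg y)) q τ Q) :
    Ht m (.seq (.copy x y) q) (τ + 2) Q := seq_of_step (fun _ => rfl) h
theorem incr_seq {x : ℕ} (h : Ht (m.setReg x (m.reg x + 1)) q τ Q) :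
    Ht m (.seq (.incr x) q) (τ + 2) Q := seq_of_step (fun _ => rfl) h
theorem decr_seq {x : ℕ} (h : Ht (m.setReg x (m.reg x - 1)) q τ Q) :
    Ht m (.seq (.decr x) q) (τ + 2) Q := seq_of_step (fun _ => rfl) h
theorem load_seq {x a y : ℕ} (h : Ht (m.setReg x (m.arr a (m.reg y))) q τ Q) :
    Ht m (.seq (.load x a y) q) (τ + 2) Q := seq_of_step (fun _ => rfl) h
theorem store_seq {a x y : ℕ} (h : Ht (m.setArr a (m.reg x) (m.reg y)) q τ Q) :
    Ht m (.seq (.store a x y) q) (τ + 2) Q := seq_of_step (fun _ => rfl) h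

theorem ite {x y : ℕ} (hp : m.reg x < m.reg y → Ht m p τ Q) (hq : m.reg y ≤ m.reg x → Ht m q τ Q) :
    Ht m (.ite x y p q) (τ + 1) Q := by
  intro g K B T hB
  rw [Nat.cast_add, Nat.cast_one, add_comm (τ : ℝ≥0∞), add_assoc]
  by_cases h : m.reg x < m.reg y
  · refine (cost_le_of_step (c := ⟨p :: K, m⟩) (by simp [step, h])).trans ?_
    gcongr
    exact hp h g K B T hB
  · refine (cost_le_of_step (c := ⟨q :: K, m⟩) (by simp [step, h])).trans ?_
    gcongr
    exact hq (not_lt.1 h) g K B T hB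

theorem loop_exit {x y : ℕ} (h : m.reg y ≤ m.reg x) (hQ : Q m) : Ht m (.loop x y p) 1 Q :=
  of_step (fun K => by simp [step, h.not_gt]) hQ

theorem loop_step {x y : ℕ} (h : m.reg x < m.reg y) (hp : Ht m p τ R)
    (hl : ∀ m', R m' → Ht m' (.loop x y p) τ' Q) : Ht m (.loop x y p) (1 + τ + τ') Q := by
  intro g K B T hB
  refine (cost_le_of_step (c := ⟨p :: .loop x y p :: K, m⟩) (by simp [step, h])).trans ?_
  push_cast
  rw [add_assoc, add_assoc]
  gcongr
  exact hp g _ _ T fun m' hm' => hl m' hm' g K B T hB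

/-- A loop whose counter runs from `j` up to `N`. -/
theorem loop_count {x y : ℕ} {N : ℕ} (I : ℕ → Memory → Prop)
    (hI : ∀ j m, I j m → m.reg x = j ∧ m.reg y = N)
    (hstep : ∀ j m, j < N → I j m → Ht m p τ (I (j + 1)))
    (hend : ∀ m, I N m → Q m) {j : ℕ} (hj : j ≤ N) (hm : I j m) :
    Ht m (.loop x y p) ((N - j) * (τ + 1) + 1) Q := by
  obtain ⟨e, rfl⟩ := Nat.exists_eq_add_of_le hj
  clear hj
  induction e generalizing j m with
  | zero =>
    refine (loop_exit ?_ (hend m hm)).weaken (by omega)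
    rw [(hI _ _ hm).1, (hI _ _ hm).2, add_zero]
  | succ e ih =>
    refine (loop_step (τ' := e * (τ + 1) + 1) ?_ (hstep j m (by omega) hm) fun m' hm' => ?_).weaken ?_
    · rw [(hI _ _ hm).1, (hI _ _ hm).2]; omega
    · refine (ih (j := j + 1) hm' ?_ ?_ ?_).weaken ?_
      · intro i m hi; refine ⟨(hI i m hi).1, ?_⟩; rw [(hI i m hi).2]; omega
      · intro i m h1 h2; exact hstep i m (by omega) h2
      · intro m h; refine hend m ?_; rw [show j + (e + 1) = j + 1 + e by omega]; exact h
      · rw [show j + 1 + e - (j + 1) = e by omega]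
    · rw [show j + (e + 1) - j = e + 1 by omega]; ring_nf; omega

end Ht

end RAM

/-! ### The random walk on partial transversals -/

namespace TransversalWalk

open scoped NNReal

open Finset Function

theorem sum_comp_le_sum {α β : Type*} {s : Finset α} {t : Finset β} (g : α → β)
    (hg : ∀ a ∈ s, g a ∈ t) (hinj : Set.InjOn g s) (F : β → ℝ≥0) :
    ∑ a ∈ s, F (g a) ≤ ∑ b ∈ t, F b := by
  classical
  rw [← Finset.sum_image (f := F) (g := g) (s := s) hinj]
  exact Finset.sum_le_sum_of_subset (Finset.image_subset_iff.2 hg)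

/-! ### The potential of a stack -/

section Weight

variable {ι : Type*}

/-- The weight of a stack; `x` and `y` are the factors for a block that is, respectively is not,
joined by an edge to the next block of the stack. -/
noncomputable def weight (e : ι → ι → ℕ) (x y : ℝ) : List ι → ℝ
  | [] => 0
  | [_] => 1
  | j :: p :: r => (if 0 < e j p then x else y) * weight e x y (p :: r)

theorem weight_nonneg {e : ι → ι → ℕ} {x y : ℝ} (hx : 0 ≤ x) (hy : 0 ≤ y) (σ : List ι) :
    0 ≤ weight e x y σ := by
  fun_induction weight with
  | case1 => exact le_rfl
  | case2 => exact zero_le_one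
  | case3 j p r ih => split_ifs <;> positivity

theorem pow_le_weight {e : ι → ι → ℕ} {x y : ℝ} (hx : 0 ≤ x) (hxy : x ≤ y) (j : ι) (σ : List ι) :
    x ^ σ.length ≤ weight e x y (j :: σ) := by
  induction σ generalizing j with
  | nil => simp [weight]
  | cons p r ih =>
    rw [weight, List.length_cons, pow_succ']
    refine mul_le_mul ?_ (ih p) (by positivity) ?_
    · split_ifs <;> linarith
    · split_ifs <;> linarith

theorem weight_le_pow {e : ι → ι → ℕ} {x y : ℝ} (hx : 0 ≤ x) (hxy : x ≤ y) (j : ι) (σ : List ι) :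
    weight e x y (j :: σ) ≤ y ^ σ.length := by
  induction σ generalizing j with
  | nil => simp [weight]
  | cons p r ih =>
    rw [weight, List.length_cons, pow_succ']
    refine mul_le_mul ?_ (ih p) (weight_nonneg hx (hx.trans hxy) _) (hx.trans hxy)
    split_ifs <;> linarith

end Weight

/-! ### Survival of the walk and the recursion for its sums -/

variable {V ι : Type*} [DecidableEq ι]

/-- The probability that the walk is not finished after `t` rounds. A state consists of the stack
of the blocks without a vertex and of the chosen vertices of the other blocks. In each round the
top block `j` draws a vertex `w` from its list; if `pick I w = some i`, then block `i` loses its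
vertex and is pushed on the stack, and otherwise `w` becomes the vertex of `j`. -/
noncomputable def surv (cand : ι → List V) (pick : (ι → Option V) → V → Option ι) :
    ℕ → List ι → (ι → Option V) → ℝ≥0
  | _, [], _ => 0
  | 0, _ :: _, _ => 1
  | t + 1, j :: σ, I => ((cand j).length : ℝ≥0)⁻¹ * ((cand j).map fun w =>
      match pick I w with
      | none => surv cand pick t σ (update I j (some w))
      | some i => surv cand pick t (i :: j :: σ) (update I i none)).sum

theorem surv_nil (cand : ι → List V) (pick : (ι → Option V) → V → Option ι) (t : ℕ)
    (I : ι → Option V) : surv cand pick t [] I = 0 := by cases t <;> rfl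

theorem surv_le_one (cand : ι → List V) (pick : (ι → Option V) → V → Option ι) (t : ℕ)
    (σ : List ι) (I : ι → Option V) : surv cand pick t σ I ≤ 1 := by
  induction t generalizing σ I with
  | zero => cases σ <;> simp [surv]
  | succ t ih =>
    cases σ with
    | nil => simp [surv]
    | cons j σ =>
      rw [surv]
      refine (mul_le_mul_right (List.sum_le_card_nsmul _ 1 ?_) _).trans ?_
      · simp only [List.mem_map, forall_exists_index, and_imp, forall_apply_eq_imp_iff₂]
        intro w _
        split <;> exact ih _ _
      · rw [List.length_map, nsmul_eq_mul, mul_one]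
        exact inv_mul_le_one

variable [Fintype ι] [DecidableEq V]

/-- The choices of one vertex for each block outside `σ`. -/
def choices (cand : ι → List V) (σ : List ι) : Finset (ι → Option V) :=
  Fintype.piFinset fun i => if i ∈ σ then {none} else (cand i).toFinset.image some

/-- The sum of `surv` over all choices of vertices outside the stack. -/
noncomputable def total (cand : ι → List V) (pick : (ι → Option V) → V → Option ι)
    (t : ℕ) (σ : List ι) : ℝ≥0 :=
  ∑ I ∈ choices cand σ, surv cand pick t σ I

/-- The pairs of adjacent candidates of two blocks. -/
def edges (cand : ι → List V) (Adj : V → V → Prop) [DecidableRel Adj] (j i : ι) : Finset (V × V) :=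
  ((cand j).toFinset ×ˢ (cand i).toFinset).filter fun e => Adj e.1 e.2

theorem mem_choices {cand : ι → List V} {σ : List ι} {I : ι → Option V} :
    I ∈ choices cand σ ↔ ∀ i, (i ∈ σ → I i = none) ∧ (i ∉ σ → ∃ w ∈ cand i, I i = some w) := by
  simp only [choices, Fintype.mem_piFinset]
  refine forall_congr' fun i => ?_
  by_cases h : i ∈ σ
  · simp [h]
  · simp [h, eq_comm]

/-- Expanding one round turns the left side into a sum over pairs of a choice `I` and a draw `w`.
The successful pairs inject into the choices outside `σ`. A pair with conflict in block `i` injects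
into the pairs of an edge and a choice outside `i :: j :: σ`, since the edge remembers both `w` and
the deleted vertex. -/
theorem total_succ_le {cand : ι → List V} (hnd : ∀ i, (cand i).Nodup)
    {Adj : V → V → Prop} [DecidableRel Adj]
    {pick : (ι → Option V) → V → Option ι}
    (hpick : ∀ I w i, pick I w = some i → ∃ u, I i = some u ∧ Adj w u) (t : ℕ)
    {j : ι} {σ : List ι} (hj : j ∉ σ) :
    ((cand j).length : ℝ≥0) * total cand pick (t + 1) (j :: σ) ≤ total cand pick t σ +
      ∑ i ∈ univ.filter (· ∉ j :: σ),
        ((edges cand Adj j i).card : ℝ≥0) * total cand pick t (i :: j :: σ) := by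
  set G : (ι → Option V) × V → ℝ≥0 := fun x =>
    match pick x.1 x.2 with
      | none => surv cand pick t σ (update x.1 j (some x.2))
      | some i => surv cand pick t (i :: j :: σ) (update x.1 i none) with hG
  have h1 : ((cand j).length : ℝ≥0) * total cand pick (t + 1) (j :: σ) ≤
      ∑ x ∈ choices cand (j :: σ) ×ˢ (cand j).toFinset, G x := by
    rw [total, Finset.mul_sum, Finset.sum_product]
    refine Finset.sum_le_sum fun I _ => ?_
    rw [surv, ← mul_assoc, List.sum_toFinset _ (hnd j)]
    exact mul_le_of_le_one_left zero_le mul_inv_le_one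
  refine h1.trans ?_
  rw [← Finset.sum_filter_add_sum_filter_not _ (fun x => pick x.1 x.2 = none)]
  gcongr ?_ + ?_
  · have : ∀ x ∈ (choices cand (j :: σ) ×ˢ (cand j).toFinset).filter (fun x => pick x.1 x.2 = none),
        G x = surv cand pick t σ (update x.1 j (some x.2)) := by
      intro x hx
      simp only [hG, (Finset.mem_filter.1 hx).2]
    rw [Finset.sum_congr rfl this, total]
    refine sum_comp_le_sum (fun x : (ι → Option V) × V => update x.1 j (some x.2)) ?_ ?_ _
    · rintro ⟨I, w⟩ hx
      simp only [mem_filter, mem_product, mem_choices, List.mem_toFinset] at hx ⊢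
      intro i
      obtain ⟨⟨hI, hw⟩, -⟩ := hx
      by_cases hij : i = j
      · subst hij
        simp [hj, hw]
      · have := hI i
        simpa [hij] using this
    -- The entry at `j` reveals `w`; before the update it was `none`, because `j` is on the stack.
    · rintro ⟨I, w⟩ hx ⟨I', w'⟩ hx' heq
      simp only [coe_filter, mem_product, mem_choices, List.mem_toFinset, Set.mem_ofPred_eq] at hx hx'
      have hw := congrFun heq j
      simp only [update_self, Option.some.injEq] at hw
      refine Prod.ext (funext fun i => ?_) hw
      by_cases hij : i = j
      · subst hij
        exact ((hx.1.1 i).1 (by simp)).trans ((hx'.1.1 i).1 (by simp)).symm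
      · simpa [hij] using congrFun heq i
  · have h2 : ∀ i ∈ univ.filter (· ∉ j :: σ),
        ((edges cand Adj j i).card : ℝ≥0) * total cand pick t (i :: j :: σ) =
          ∑ _e ∈ edges cand Adj j i, ∑ I ∈ choices cand (i :: j :: σ),
            surv cand pick t (i :: j :: σ) I := by
      intro i _
      rw [Finset.sum_const, nsmul_eq_mul, total]
    rw [Finset.sum_congr rfl h2]
    simp_rw [Finset.sum_sigma']
    -- The default values of `getD` only make the map total; they are never attained where a
    -- conflict exists.
    have : ∀ x ∈ (choices cand (j :: σ) ×ˢ (cand j).toFinset).filter (fun x => ¬ pick x.1 x.2 = none),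
        G x = (fun y : (_ : ι) × (_ : V × V) × (ι → Option V) =>
          surv cand pick t (y.1 :: j :: σ) y.2.2)
          ⟨(pick x.1 x.2).getD j, (x.2, (x.1 ((pick x.1 x.2).getD j)).getD x.2),
            update x.1 ((pick x.1 x.2).getD j) none⟩ := by
      intro x hx
      obtain ⟨i, hi⟩ := Option.ne_none_iff_exists'.1 (Finset.mem_filter.1 hx).2
      simp only [hG, hi, Option.getD_some]
    rw [Finset.sum_congr rfl this]
    refine sum_comp_le_sum (fun x : (ι → Option V) × V =>
      (⟨(pick x.1 x.2).getD j, (x.2, (x.1 ((pick x.1 x.2).getD j)).getD x.2),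
            update x.1 ((pick x.1 x.2).getD j) none⟩ : (_ : ι) × (_ : V × V) × (ι → Option V)))
      ?_ ?_ (fun y => surv cand pick t (y.1 :: j :: σ) y.2.2)
    · rintro ⟨I, w⟩ hx
      simp only [mem_filter, mem_product, mem_choices, List.mem_toFinset] at hx
      obtain ⟨⟨hI, hw⟩, hp⟩ := hx
      obtain ⟨i, hi⟩ := Option.ne_none_iff_exists'.1 hp
      obtain ⟨u, hu, hwu⟩ := hpick _ _ _ hi
      have hi' : i ∉ j :: σ := fun h => by simp [(hI i).1 h] at hu
      obtain ⟨u', hu', hu''⟩ := (hI i).2 hi'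
      obtain rfl : u' = u := by rw [hu] at hu''; exact (Option.some.inj hu'').symm
      simp only [hi, Option.getD_some, hu, mem_sigma, mem_filter, mem_univ, true_and, edges,
        mem_product, List.mem_toFinset, mem_choices]
      refine ⟨hi', ⟨⟨hw, hu'⟩, hwu⟩, fun l => ?_⟩
      by_cases hl : l = i
      · subst hl; simp
      · have := hI l
        simpa [hl] using this
    · rintro ⟨I, w⟩ hx ⟨I', w'⟩ hx' heq
      simp only [coe_filter, Set.mem_ofPred_eq] at hx hx'
      obtain ⟨i, hi⟩ := Option.ne_none_iff_exists'.1 hx.2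
      obtain ⟨i', hi'⟩ := Option.ne_none_iff_exists'.1 hx'.2
      obtain ⟨u, hu, -⟩ := hpick _ _ _ hi
      obtain ⟨u', hu', -⟩ := hpick _ _ _ hi'
      simp only [hi, hi', Option.getD_some, hu, hu', Sigma.mk.injEq, heq_eq_eq, Prod.mk.injEq] at heq
      obtain ⟨rfl, ⟨rfl, rfl⟩, hII⟩ := heq
      refine Prod.ext (funext fun l => ?_) rfl
      by_cases hl : l = i
      · subst hl; simp [hu, hu']
      · simpa [hl] using congrFun hII l

end TransversalWalk

/-! ### Geometric decay and the expected number of rounds -/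

namespace TransversalWalk

open scoped NNReal

open Finset Function

/-- At `η = 0` the last inequality is an equality, while the one before it has slack `x * x`, which
is about `2η`. Lowering `x` by the factor `1 - η` spends part of this slack to gain `η` in the last
inequality, where `ρ = 1 - η / 2` then gives equality. -/
theorem numeric_bounds {d : ℝ} (hd : 1 ≤ d) {η x y ρ : ℝ} (hη : η = 1 / (8 * d ^ 2))
    (hx : x = (1 - η) / (2 * d)) (hy : y = 1 / (2 * d)) (hρ : ρ = 1 - η / 2) :
    0 ≤ x ∧ x ≤ y ∧ 0 ≤ ρ ∧ d * x ≤ ρ ∧ 1 ≤ 4 * d * x ∧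
      1 + (4 * d * d - 1) * (x * x) ≤ 4 * d * (ρ * x) ∧
      1 + 4 * d * d * (x * y) ≤ 4 * d * (ρ * y) := by
  have hd0 : 0 < d := by linarith
  have hη0 : 0 < η := by rw [hη]; positivity
  have hη1 : η ≤ 1 / 8 := by
    rw [hη]
    apply one_div_le_one_div_of_le (by norm_num)
    nlinarith
  have hdx : d * x = (1 - η) / 2 := by rw [hx]; field_simp
  have hdy : d * y = 1 / 2 := by rw [hy]; field_simp
  have hxx : x * x = 2 * η * (1 - η) ^ 2 := by rw [hx, hη]; field_simp; ring
  refine ⟨?_, ?_, ?_, ?_, ?_, ?_, ?_⟩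
  · rw [hx]; apply div_nonneg <;> linarith
  · rw [hx, hy]; gcongr; linarith
  · rw [hρ]; linarith
  · rw [hdx, hρ]; linarith
  · rw [mul_assoc, hdx]; linarith
  · have h1 : 4 * d * (ρ * x) = 4 * ρ * (d * x) := by ring
    have h2 : (4 * d * d - 1) * (x * x) = 4 * (d * x) ^ 2 - x * x := by ring
    rw [h1, h2, hdx, hxx, hρ]
    nlinarith [mul_nonneg hη0.le (sub_nonneg.2 hη1), mul_pos hη0 hη0,
      mul_nonneg (mul_nonneg hη0.le hη0.le) hη0.le]
  · have h1 : 4 * d * (ρ * y) = 4 * ρ * (d * y) := by ring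
    have h2 : 4 * d * d * (x * y) = 4 * (d * x) * (d * y) := by ring
    rw [h1, h2, hdx, hdy, hρ]
    linarith

variable {V ι : Type*} [DecidableEq V]

/-- The edge sets for different `i` are disjoint because the second endpoint determines its block;
each first endpoint lies on at most `d` edges. -/
theorem sum_card_edges_le [DecidableEq ι] {cand : ι → List V} {blk : V → ι} (hblk : ∀ i, ∀ w ∈ cand i, blk w = i)
    {Adj : V → V → Prop} [DecidableRel Adj] {d : ℕ}
    (hdeg : ∀ w, ∀ s : Finset V, (∀ u ∈ s, Adj w u) → s.card ≤ d) (j : ι) (S : Finset ι) :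
    ∑ i ∈ S, (edges cand Adj j i).card ≤ (cand j).length * d := by
  rw [← Finset.card_biUnion]
  · have hm : ∀ e ∈ S.biUnion (edges cand Adj j), e.1 ∈ (cand j).toFinset := by
      intro e he
      simp only [edges, mem_biUnion, mem_filter, mem_product] at he
      obtain ⟨i, -, he, -⟩ := he
      exact he.1
    rw [Finset.card_eq_sum_card_fiberwise hm]
    refine (Finset.sum_le_card_nsmul _ _ d fun w hw => ?_).trans ?_
    · rw [← Finset.card_image_of_injOn (f := Prod.snd)]
      · refine hdeg w _ fun u hu => ?_
        simp only [edges, mem_image, mem_filter, mem_biUnion, mem_product] at hu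
        obtain ⟨⟨a, b⟩, ⟨⟨i, -, -, he⟩, rfl⟩, rfl⟩ := hu
        exact he
      · rintro ⟨a, b⟩ h ⟨a', b'⟩ h' hb
        simp only [coe_filter, Set.mem_ofPred_eq] at h h'
        exact Prod.ext (h.2.trans h'.2.symm) hb
    · rw [smul_eq_mul]
      gcongr
      exact List.toFinset_card_le _
  · intro i _ i' _ hne
    refine Finset.disjoint_left.2 ?_
    intro e he he'
    simp only [edges, mem_filter, mem_product, List.mem_toFinset] at he he'
    exact hne ((hblk _ _ he.1.2).symm.trans (hblk _ _ he'.1.2))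

theorem card_edges_comm {cand : ι → List V} {Adj : V → V → Prop} [DecidableRel Adj]
    (hsymm : ∀ u w, Adj u w → Adj w u) (i j : ι) :
    (edges cand Adj i j).card = (edges cand Adj j i).card := by
  refine Finset.card_bij' (fun e _ => e.swap) (fun e _ => e.swap) ?_ ?_ ?_ ?_
  · intro e he
    simp only [edges, mem_filter, mem_product, Prod.fst_swap, Prod.snd_swap] at he ⊢
    exact ⟨he.1.symm, hsymm _ _ he.2⟩
  · intro e he
    simp only [edges, mem_filter, mem_product, Prod.fst_swap, Prod.snd_swap] at he ⊢
    exact ⟨he.1.symm, hsymm _ _ he.2⟩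
  · simp
  · simp

variable [DecidableEq ι] [Fintype ι]

/-- Induction on `t`. `h2` serves the start, where each level of the stack removes a factor `4 * d`
from the number of choices; `h1` serves the stack `[z]`; `h3` and `h4` serve a top block that is, or
is not, joined to the block below it. -/
theorem total_le {cand : ι → List V} {blk : V → ι} (hblk : ∀ i, ∀ w ∈ cand i, blk w = i)
    (hnd : ∀ i, (cand i).Nodup) {d : ℕ} {z : ι} (hz : (cand z).length = 1)
    (hlen : ∀ i, i ≠ z → (cand i).length = 4 * d)
    {Adj : V → V → Prop} [DecidableRel Adj] (hsymm : ∀ u w, Adj u w → Adj w u)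
    (hdeg : ∀ w, ∀ s : Finset V, (∀ u ∈ s, Adj w u) → s.card ≤ d)
    {pick : (ι → Option V) → V → Option ι}
    (hpick : ∀ I w i, pick I w = some i → ∃ u, I i = some u ∧ Adj w u)
    {x y ρ : ℝ} (hx : 0 ≤ x) (hxy : x ≤ y) (hρ : 0 ≤ ρ) (h1 : d * x ≤ ρ) (h2 : 1 ≤ 4 * d * x)
    (h3 : 1 + (4 * d * d - 1) * (x * x) ≤ 4 * d * (ρ * x))
    (h4 : 1 + 4 * d * d * (x * y) ≤ 4 * d * (ρ * y))
    (t : ℕ) (σ : List ι) (hσ : σ.Nodup) (hσz : σ = [] ∨ ∃ τ, σ = τ ++ [z]) :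
    (total cand pick t σ : ℝ) ≤ (4 * d : ℝ) ^ (Fintype.card ι - 1) *
      weight (fun i j => (edges cand Adj i j).card) x y σ * ρ ^ t := by
  have hd0 : (0 : ℝ) < 4 * d := by
    rcases Nat.eq_zero_or_pos d with rfl | h
    · norm_num at h2
    · positivity
  set M : ℝ := (4 * d : ℝ) ^ (Fintype.card ι - 1) with hM
  have hM0 : 0 ≤ M := by positivity
  set e : ι → ι → ℕ := fun i j => (edges cand Adj i j).card with he
  have hesum : ∀ j S, (∑ i ∈ S, (e j i : ℝ)) ≤ (cand j).length * d := by
    intro j S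
    exact_mod_cast sum_card_edges_le hblk hdeg j S
  induction t generalizing σ with
  | zero =>
    cases σ with
    | nil => simp [total, surv, weight]
    | cons j σ =>
      have hzσ : z ∈ j :: σ := by
        rcases hσz with h | ⟨τ, h⟩
        · cases h
        · rw [h]; simp
      have hcard : (total cand pick 0 (j :: σ) : ℝ) ≤
          (4 * d : ℝ) ^ (Fintype.card ι - (σ.length + 1)) := by
        have : total cand pick 0 (j :: σ) = ((choices cand (j :: σ)).card : ℝ≥0) := by
          simp [total, surv]
        rw [this]
        have h5 : (choices cand (j :: σ)).card ≤ (4 * d) ^ (Fintype.card ι - (σ.length + 1)) := by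
          rw [choices, Fintype.card_piFinset]
          calc _ ≤ ∏ i : ι, if i ∈ j :: σ then 1 else 4 * d := by
                refine Finset.prod_le_prod' fun i _ => ?_
                split_ifs with h
                · simp
                · refine Finset.card_image_le.trans ((List.toFinset_card_le _).trans ?_)
                  rw [hlen i (fun h' => h (h' ▸ hzσ))]
            _ = (4 * d) ^ (Fintype.card ι - (σ.length + 1)) := by
                rw [Finset.prod_ite, Finset.prod_const_one, one_mul, Finset.prod_const]
                congr 1
                rw [← Finset.compl_filter, Finset.card_compl]
                congr 1
                have : ({i | i ∈ j :: σ} : Finset ι) = (j :: σ).toFinset := by ext; simp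
                rw [this, List.toFinset_card_of_nodup hσ, List.length_cons]
        exact_mod_cast h5
      refine hcard.trans ?_
      have hle : σ.length + 1 ≤ Fintype.card ι := by
        rw [← List.length_cons (a := j)]
        exact hσ.length_le_card
      rw [pow_zero, mul_one]
      calc (4 * d : ℝ) ^ (Fintype.card ι - (σ.length + 1))
          ≤ (4 * d : ℝ) ^ (Fintype.card ι - (σ.length + 1)) * (4 * d * x) ^ σ.length :=
            le_mul_of_one_le_right (by positivity) (one_le_pow₀ h2)
        _ = M * x ^ σ.length := by
            rw [mul_pow (4 * d : ℝ) x, ← mul_assoc, ← pow_add, hM]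
            congr 3
            omega
        _ ≤ _ := by
            gcongr
            exact pow_le_weight hx hxy j σ
  | succ t ih =>
    cases σ with
    | nil => simp [total, surv, weight]
    | cons j σ =>
      have hstep : ((cand j).length : ℝ) * total cand pick (t + 1) (j :: σ) ≤
          total cand pick t σ + ∑ i ∈ univ.filter (· ∉ j :: σ),
            (e j i : ℝ) * total cand pick t (i :: j :: σ) := by
        exact_mod_cast total_succ_le hnd hpick t (List.nodup_cons.1 hσ).1
      have hpush : ∀ i ∈ univ.filter (· ∉ j :: σ), (e j i : ℝ) * total cand pick t (i :: j :: σ) ≤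
          e j i * (M * (x * weight e x y (j :: σ)) * ρ ^ t) := by
        intro i hi
        rcases Nat.eq_zero_or_pos (e j i) with h0 | hpos
        · simp [h0]
        · gcongr
          refine (ih _ (List.nodup_cons.2 ⟨(Finset.mem_filter.1 hi).2, hσ⟩) (.inr ?_)).trans_eq ?_
          · rcases hσz with h | ⟨τ, h⟩
            · cases h
            · exact ⟨i :: τ, by rw [h]; rfl⟩
          -- Only blocks joined to `j` can be pushed on it, so a push always contributes the smaller
          -- factor `x`.
          · have : 0 < e i j := by
              rw [he]
              simpa only [card_edges_comm hsymm i j] using hpos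
            rw [weight, if_pos this]
      have hstep2 := hstep.trans (add_le_add_right (Finset.sum_le_sum hpush) _)
      rw [← Finset.sum_mul] at hstep2
      cases σ with
      | nil =>
        have hjz : j = z := by
          rcases hσz with h | ⟨τ, h⟩
          · cases h
          · rcases τ with _ | ⟨a, τ⟩
            · simpa using h
            · simp at h
        subst hjz
        -- With only `z` on the stack a success ends the walk, so only pushes contribute; the single
        -- candidate has at most `d` edges.
        have h0 : total cand pick t [] = 0 := by simp [total, surv_nil]
        rw [hz, h0] at hstep2
        simp only [Nat.cast_one, one_mul, NNReal.coe_zero, zero_add] at hstep2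
        refine hstep2.trans ?_
        have hs := hesum j (univ.filter (· ∉ [j]))
        rw [hz, Nat.cast_one, one_mul] at hs
        simp only [weight, mul_one] at hs ⊢
        calc _ ≤ (d : ℝ) * (M * x * ρ ^ t) := by gcongr
          _ = M * (d * x) * ρ ^ t := by ring
          _ ≤ M * ρ * ρ ^ t := by gcongr
          _ = M * ρ ^ (t + 1) := by ring
      | cons p r =>
        have hjz : j ≠ z := by
          rintro rfl
          rcases hσz with h | ⟨τ, h⟩
          · cases h
          · have := (List.nodup_cons.1 hσ).1
            rcases τ with _ | ⟨a, τ⟩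
            · simp at h
            · simp only [List.cons_append, List.cons.injEq] at h
              rw [h.2] at this
              simp at this
        have hp : (p :: r).Nodup := (List.nodup_cons.1 hσ).2
        have hpz : p :: r = [] ∨ ∃ τ, p :: r = τ ++ [z] := by
          rcases hσz with h | ⟨τ, h⟩
          · cases h
          · rcases τ with _ | ⟨a, τ⟩
            · simp at h
            · exact .inr ⟨τ, (List.cons.inj h).2⟩
        have hlj := hlen j hjz
        rw [hlj] at hstep2
        have h6 := ih _ hp hpz
        -- The degree bound is applied with `p` included: its edges count towards `4 * d * d` but do
        -- not occur in `E`, as `p` is on the stack.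
        have hs := hesum j (insert p (univ.filter (· ∉ j :: p :: r)))
        rw [Finset.sum_insert (by simp), hlj] at hs
        push_cast at hs hstep2
        set E : ℝ := ∑ i ∈ univ.filter (· ∉ j :: p :: r), (e j i : ℝ) with hE
        have hW := weight_nonneg (e := e) hx (hx.trans hxy) (p :: r)
        set W := weight e x y (p :: r) with hWdef
        have hf : 1 + E * (x * (if 0 < e j p then x else y)) ≤
            4 * d * (ρ * (if 0 < e j p then x else y)) := by
          split_ifs with h
          · have : (1 : ℝ) ≤ e j p := by exact_mod_cast h
            refine le_trans ?_ h3
            gcongr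
            linarith
          · refine le_trans ?_ h4
            have : (0 : ℝ) ≤ e j p := by positivity
            have hy := hx.trans hxy
            gcongr
            linarith
        rw [weight, ← hWdef] at hstep2 ⊢
        set f : ℝ := if 0 < e j p then x else y with hfdef
        have h7 : (4 * d : ℝ) * total cand pick (t + 1) (j :: p :: r) ≤
            4 * d * (M * (f * W) * ρ ^ (t + 1)) := by
          calc _ ≤ M * W * ρ ^ t + E * (M * (x * (f * W)) * ρ ^ t) :=
                hstep2.trans (add_le_add_left h6 _)
            _ = M * W * ρ ^ t * (1 + E * (x * f)) := by ring
            _ ≤ M * W * ρ ^ t * (4 * d * (ρ * f)) := by gcongr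
            _ = _ := by ring
        exact le_of_mul_le_mul_left h7 hd0

/-- Bernoulli's inequality for the reciprocal `1 + 1 / (N - 1)`. -/
theorem pow_le_half {N : ℕ} (hN : 1 ≤ N) : (1 - 1 / (N : ℝ)) ^ N ≤ 1 / 2 := by
  rcases hN.eq_or_lt with rfl | hN
  · norm_num
  have h0 : (1 : ℝ) < N := by exact_mod_cast hN
  have hb : (2 : ℝ) ≤ (1 + 1 / ((N : ℝ) - 1)) ^ N := by
    refine le_trans ?_ (one_add_mul_le_pow (a := 1 / ((N : ℝ) - 1)) ?_ N)
    · have : (N : ℝ) * (1 / (N - 1)) = 1 + 1 / (N - 1) := by field_simp [sub_ne_zero.2 h0.ne']; ring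
      have h1 : 0 < 1 / ((N : ℝ) - 1) := by apply div_pos one_pos; linarith
      linarith
    · have h1 : 0 < 1 / ((N : ℝ) - 1) := by apply div_pos one_pos; linarith
      linarith
  have : 1 - 1 / (N : ℝ) = (1 + 1 / ((N : ℝ) - 1))⁻¹ := by
    have h1 : (N : ℝ) - 1 ≠ 0 := sub_ne_zero.2 h0.ne'
    have h2 : (N : ℝ) ≠ 0 := by linarith
    rw [one_add_div h1, sub_add_cancel, inv_div, sub_div, div_self h2]
  rw [this, inv_pow]
  simpa only [one_div] using inv_anti₀ two_pos hb

/-- The expected number of rounds of the walk on partial transversals. -/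
theorem sum_surv_le {cand : ι → List V} {blk : V → ι} (hblk : ∀ i, ∀ w ∈ cand i, blk w = i)
    (hnd : ∀ i, (cand i).Nodup) {d : ℕ} (hd : 1 ≤ d) {z : ι} (hz : (cand z).length = 1)
    (hlen : ∀ i, i ≠ z → (cand i).length = 4 * d)
    {Adj : V → V → Prop} [DecidableRel Adj] (hsymm : ∀ u w, Adj u w → Adj w u)
    (hdeg : ∀ w, ∀ s : Finset V, (∀ u ∈ s, Adj w u) → s.card ≤ d)
    {pick : (ι → Option V) → V → Option ι}
    (hpick : ∀ I w i, pick I w = some i → ∃ u, I i = some u ∧ Adj w u)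
    {σ : List ι} (hσ : (σ ++ [z]).Nodup) (hall : ∀ i, i ∈ σ ++ [z]) (T : ℕ) :
    ∑ t ∈ range T, surv cand pick t (σ ++ [z]) (fun _ => none) ≤ 16 * d ^ 2 * Fintype.card ι := by
  have hd' : (1 : ℝ) ≤ d := by exact_mod_cast hd
  obtain ⟨hx, hxy, hρ, h1, h2, h3, h4⟩ := numeric_bounds hd' rfl rfl rfl rfl
  set x : ℝ := (1 - 1 / (8 * (d : ℝ) ^ 2)) / (2 * d) with hxdef
  set y : ℝ := 1 / (2 * (d : ℝ)) with hydef
  set ρ : ℝ := 1 - 1 / (8 * (d : ℝ) ^ 2) / 2 with hρdef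
  set N : ℕ := 16 * d ^ 2 with hN
  have hNpos : 1 ≤ N := by rw [hN]; nlinarith [Nat.one_le_pow 2 d hd]
  have hρN : ρ = 1 - 1 / (N : ℝ) := by rw [hρdef, hN]; push_cast; field_simp; ring
  set K := Fintype.card ι - 1 with hK
  have hcard : 1 ≤ Fintype.card ι := Fintype.card_pos_iff.2 ⟨z⟩
  have hlenσ : (σ ++ [z]).length = Fintype.card ι := by
    rw [← List.toFinset_card_of_nodup hσ, ← Finset.card_univ]
    congr 1
    ext i
    simpa [or_comm] using hall i
  have htail : ∀ t, (surv cand pick t (σ ++ [z]) (fun _ => none) : ℝ) ≤ 2 ^ K * ρ ^ t := by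
    intro t
    -- With every block on the stack only the empty choice remains, so the sum over choices is a
    -- single probability.
    have htot : total cand pick t (σ ++ [z]) = surv cand pick t (σ ++ [z]) fun _ => none := by
      rw [total, Finset.sum_eq_single]
      · intro I hI hne
        refine absurd (funext fun i => ?_) hne
        exact (mem_choices.1 hI i).1 (hall i)
      · intro h
        refine absurd (mem_choices.2 fun i => ⟨fun _ => rfl, fun hi => absurd (hall i) hi⟩) h
    have := total_le hblk hnd hz hlen hsymm hdeg hpick hx hxy hρ h1 h2 h3 h4 t (σ ++ [z]) hσ
      (.inr ⟨σ, rfl⟩)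
    rw [htot] at this
    refine this.trans ?_
    have hw : weight (fun i j => (edges cand Adj i j).card) x y (σ ++ [z]) ≤ y ^ K := by
      obtain ⟨a, l, hal⟩ : ∃ a l, σ ++ [z] = a :: l := by
        cases σ with
        | nil => exact ⟨z, [], rfl⟩
        | cons a τ => exact ⟨a, τ ++ [z], rfl⟩
      rw [hal]
      refine (weight_le_pow hx hxy a l).trans_eq ?_
      rw [hal, List.length_cons] at hlenσ
      rw [hK, ← hlenσ, Nat.add_sub_cancel]
    calc _ ≤ (4 * d : ℝ) ^ K * y ^ K * ρ ^ t := by gcongr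
      _ = 2 ^ K * ρ ^ t := by
        rw [← mul_pow]
        congr 2
        rw [hydef]
        field_simp
        norm_num
  have hgeom : ∑ t ∈ range T, ρ ^ t ≤ N := by
    have hlt : ρ < 1 := by rw [hρN]; linarith [show 0 < 1 / (N : ℝ) by positivity]
    refine (Summable.sum_le_tsum _ (fun _ _ => pow_nonneg hρ _)
      (summable_geometric_of_lt_one hρ hlt)).trans_eq ?_
    rw [tsum_geometric_of_lt_one hρ hlt, hρN]
    simp
  have hmain : (∑ t ∈ range T, (surv cand pick t (σ ++ [z]) (fun _ => none) : ℝ)) ≤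
      N * K + N := by
    -- The first `N * K` rounds are bounded by probability 1. After them `ρ ^ (N * K) ≤ 2⁻¹ ^ K`
    -- cancels the factor `2 ^ K`, and a geometric series of sum `N` remains.
    calc _ ≤ ∑ t ∈ range (N * K + T), (surv cand pick t (σ ++ [z]) (fun _ => none) : ℝ) :=
          Finset.sum_le_sum_of_subset_of_nonneg (Finset.range_subset_range.2 (by omega))
            fun _ _ _ => NNReal.coe_nonneg _
      _ = ∑ t ∈ range (N * K), (surv cand pick t (σ ++ [z]) (fun _ => none) : ℝ) +
          ∑ t ∈ range T, (surv cand pick (N * K + t) (σ ++ [z]) (fun _ => none) : ℝ) :=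
          Finset.sum_range_add _ _ _
      _ ≤ ∑ t ∈ range (N * K), (1 : ℝ) + ∑ t ∈ range T, ρ ^ t := by
          gcongr with t _ t _
          · exact_mod_cast surv_le_one _ _ _ _ _
          · refine (htail _).trans ?_
            rw [pow_add, ← mul_assoc, pow_mul, ← mul_pow]
            refine mul_le_of_le_one_left (by positivity) (pow_le_one₀ (by positivity) ?_)
            have := pow_le_half hNpos
            rw [← hρN] at this
            linarith
      _ ≤ N * K + N := by
          rw [Finset.sum_const, card_range, nsmul_eq_mul, mul_one]
          push_cast
          linarith
  have hfin : (N : ℝ) * K + N = 16 * (d : ℝ) ^ 2 * Fintype.card ι := by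
    rw [← mul_add_one, hN, ← Nat.cast_add_one, hK, Nat.sub_add_cancel hcard]
    push_cast
    ring
  rw [hfin] at hmain
  exact_mod_cast hmain

end TransversalWalk

/-! ### Framing, the input memory, and rules for loops over counters and adjacency lists -/

namespace RAM

open Function

namespace Memory

@[simp] theorem reg_setReg (m : Memory) (x v y : ℕ) :
    (m.setReg x v).reg y = if y = x then v else m.reg y := by
  simp [setReg, update_apply]

@[simp] theorem arr_setReg (m : Memory) (x v : ℕ) : (m.setReg x v).arr = m.arr := rfl

@[simp] theorem reg_setArr (m : Memory) (a i v : ℕ) : (m.setArr a i v).reg = m.reg := rfl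

@[simp] theorem arr_setArr (m : Memory) (a i v a' : ℕ) :
    (m.setArr a i v).arr a' = if a' = a then update (m.arr a) i v else m.arr a' := by
  simp [setArr, update_apply]

theorem setReg_self (m : Memory) (x : ℕ) : m.setReg x (m.reg x) = m := by
  simp [setReg]

end Memory

/-- `m'` agrees with `m` outside the registers `R` and the arrays `A`. -/
structure Same (R A : List ℕ) (m m' : Memory) : Prop where
  reg_eq : ∀ r, r ∉ R → m'.reg r = m.reg r
  arr_eq : ∀ a, a ∉ A → m'.arr a = m.arr a

namespace Same

variable {R A R' A' : List ℕ} {m m' m'' : Memory}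

theorem refl (R A : List ℕ) (m : Memory) : Same R A m m := ⟨fun _ _ => rfl, fun _ _ => rfl⟩

theorem reg (h : Same R A m m') (r : ℕ) (hr : r ∉ R := by decide) : m'.reg r = m.reg r :=
  h.reg_eq r hr

theorem arr (h : Same R A m m') (a : ℕ) (ha : a ∉ A := by decide) : m'.arr a = m.arr a :=
  h.arr_eq a ha

theorem setReg (h : Same R A m m') {x v : ℕ} (hx : x ∈ R := by decide) :
    Same R A m (m'.setReg x v) :=
  ⟨fun r hr => by simpa [show r ≠ x from fun e => hr (e ▸ hx)] using h.reg_eq r hr, h.arr_eq⟩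

theorem setArr (h : Same R A m m') {a i v : ℕ} (ha : a ∈ A := by decide) :
    Same R A m (m'.setArr a i v) :=
  ⟨h.reg_eq, fun r hr => by simpa [show r ≠ a from fun e => hr (e ▸ ha)] using h.arr_eq r hr⟩

theorem trans (h : Same R A m m') (h' : Same R' A' m' m'') (hR : R' ⊆ R := by decide)
    (hA : A' ⊆ A := by decide) : Same R A m m'' :=
  ⟨fun r hr => (h'.reg_eq r fun e => hr (hR e)).trans (h.reg_eq r hr),
    fun r hr => (h'.arr_eq r fun e => hr (hA e)).trans (h.arr_eq r hr)⟩

theorem mono (h : Same R A m m') (hR : R ⊆ R' := by decide) (hA : A ⊆ A' := by decide) :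
    Same R' A' m m' := (refl R' A' m).trans h hR hA

end Same

/-- Do nothing. -/
def skip : Prog := .copy 3 3

/-- `if x = y then p` -/
def ifEq (x y : ℕ) (p : Prog) : Prog := .ite x y skip (.ite y x skip p)

/-- `for x < y do p` -/
def forLoop (x y : ℕ) (p : Prog) : Prog := .seq (.const x 0) (.loop x y (.seq p (.incr x)))

/-- Run through the adjacency list of the vertex in register `v`; register `15` holds the current
neighbour, registers `13` and `14` its position and the end of the list. -/
def scan (v : ℕ) (p : Prog) : Prog :=
  .seq (.load 13 0 v) <| .seq (.copy 14 v) <| .seq (.incr 14) <| .seq (.load 14 0 14) <|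
    .loop 13 14 <| .seq (.load 15 1 13) <| .seq p (.incr 13)

/-- The memory holds the graph with adjacency lists `L` and the blocks `blk`. -/
structure HoldsInput {n k : ℕ} (L : Fin n → List (Fin n)) (blk : Fin n → Fin k) (m : Memory) :
    Prop where
  reg_n : m.reg 0 = n
  reg_k : m.reg 1 = k
  reg_zero : m.reg 3 = 0
  arr_succ : ∀ v : Fin n, m.arr 0 (v + 1) = m.arr 0 v + (L v).length
  arr_adj : ∀ (v : Fin n) (q : ℕ) (h : q < (L v).length), m.arr 1 (m.arr 0 v + q) = (L v)[q]
  arr_blk : ∀ v : Fin n, m.arr 2 v = blk v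

theorem HoldsInput.of_same {n k : ℕ} {L : Fin n → List (Fin n)} {blk : Fin n → Fin k}
    {m m' : Memory} {R A : List ℕ} (h : HoldsInput L blk m) (hs : Same R A m m')
    (hR : ∀ r ∈ [0, 1, 3], r ∉ R := by decide) (hA : ∀ a ∈ [0, 1, 2], a ∉ A := by decide) :
    HoldsInput L blk m' := by
  have h0 := hs.arr 0 (hA _ (by simp))
  have h1 := hs.arr 1 (hA _ (by simp))
  have h2 := hs.arr 2 (hA _ (by simp))
  constructor
  · rw [hs.reg 0 (hR _ (by simp)), h.reg_n]
  · rw [hs.reg 1 (hR _ (by simp)), h.reg_k]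
  · rw [hs.reg 3 (hR _ (by simp)), h.reg_zero]
  · rw [h0]; exact h.arr_succ
  · rw [h0, h1]; exact h.arr_adj
  · rw [h2]; exact h.arr_blk

theorem sum_take_succ {n : ℕ} (f : Fin n → ℕ) (v : Fin n) :
    (((List.finRange n).take (v + 1)).map f).sum =
      (((List.finRange n).take v).map f).sum + f v := by
  rw [List.take_add_one]
  simp

theorem holdsInput_inputMemory {n k b : ℕ} (L : Fin n → List (Fin n)) (blk : Fin n → Fin k) :
    HoldsInput L blk (inputMemory b L blk) := by
  constructor
  · rfl
  · rfl
  · rfl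
  · intro v
    exact sum_take_succ (fun u => (L u).length) v
  · intro v q h
    set l := List.finRange n with hl
    -- The list of `v` begins where the concatenated lists of the smaller vertices end.
    have hsplit : l = l.take v ++ v :: l.drop (v + 1) := by
      have hv : (v : ℕ) < l.length := by simp [hl]
      conv_lhs => rw [← List.take_append_drop v l, List.drop_eq_getElem_cons hv]
      simp [hl]
    have hoff : (inputMemory b L blk).arr 0 v = (((l.take v).flatMap L).map Fin.val).length := by
      simp only [inputMemory, List.length_map, List.length_flatMap, hl]
    change ((l.flatMap L).map Fin.val).getD _ 0 = _
    rw [hoff]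
    conv_lhs =>
      arg 1
      rw [hsplit]
    rw [List.flatMap_append, List.map_append, List.getD_append_right _ _ _ _ (by omega),
      Nat.add_sub_cancel_left, List.flatMap_cons, List.map_append,
      List.getD_append _ _ _ _ (by simpa using h), List.getD_eq_getElem _ _ (by simpa using h)]
    simp
  · intro v
    simp [inputMemory]

namespace Ht

variable {m : Memory} {p q : Prog} {τ τ' : ℕ} {Q R : Memory → Prop}

theorem skip (h : Q m) : Ht m skip 1 Q := copy (by rwa [Memory.setReg_self])

theorem ifEq {x y : ℕ} (h : m.reg x = m.reg y → Ht m p τ Q) (hne : m.reg x ≠ m.reg y → Q m) :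
    Ht m (ifEq x y p) (τ + 3) Q := by
  refine (ite (τ := τ + 2) (fun h1 => ?_) fun h1 => ?_).weaken (by omega)
  · exact (skip (hne h1.ne)).weaken (by omega)
  · refine (ite (τ := τ + 1) (fun h2 => ?_) fun h2 => ?_).weaken (by omega)
    · exact (skip (hne h2.ne')).weaken (by omega)
    · exact (h (le_antisymm h2 h1)).weaken (by omega)

theorem forLoop {x y N : ℕ} (I : ℕ → Memory → Prop)
    (hI : ∀ j m, I j m → m.reg x = j ∧ m.reg y = N) (h0 : I 0 (m.setReg x 0))
    (hbody : ∀ j m, j < N → I j m → Ht m p τ fun m' => I (j + 1) (m'.setReg x (m'.reg x + 1)))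
    (hend : ∀ m, I N m → Q m) : Ht m (forLoop x y p) (N * (τ + 3) + 3) Q := by
  refine (const_seq (loop_count (τ := 1 + τ + 1) I hI ?_ hend (Nat.zero_le _) h0)).weaken ?_
  · intro j m hj hm
    exact seq (hbody j m hj hm) fun m' hm' => incr hm'
  · rw [Nat.sub_zero]; ring_nf; omega

/-- The invariant is indexed by the part of the list already read, so bodies can be verified without
arithmetic on positions. It must not depend on register `13`, nor on the initial value of `14`. -/
theorem scan {n k : ℕ} {L : Fin n → List (Fin n)} {blk : Fin n → Fin k} (hm : HoldsInput L blk m)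
    {r : ℕ} {v : Fin n} (hv : m.reg r = v) (hr : r ≠ 13 ∧ r ≠ 14)
    (I : List (Fin n) → Memory → Prop)
    (hI : ∀ l m', I l m' → HoldsInput L blk m' ∧ m'.arr 0 = m.arr 0)
    (h0 : ∀ a b, I [] ((m.setReg 13 a).setReg 14 b))
    (hbody : ∀ (l : List (Fin n)) (u : Fin n) (l' : List (Fin n)) (m' : Memory), L v = l ++ u :: l' → I l m' → Ht (m'.setReg 15 u) p τ fun m'' =>
      m''.reg 13 = m'.reg 13 ∧ m''.reg 14 = m'.reg 14 ∧ ∀ a, I (l ++ [u]) (m''.setReg 13 a))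
    (hend : ∀ m', I (L v) m' → Q m') :
    Ht m (scan r p) ((L v).length * (τ + 5) + 9) Q := by
  obtain ⟨hr1, hr2⟩ := hr
  set o := m.arr 0 v with ho
  have key : Ht ((m.setReg 13 o).setReg 14 (o + (L v).length))
      (.loop 13 14 (.seq (.load 15 1 13) (.seq p (.incr 13))))
      ((o + (L v).length - o) * (τ + 5) + 1) Q := by
    refine (loop_count (τ := 1 + τ + 1 + 2) (N := o + (L v).length) (j := o) (fun j m' => ∃ q, j = o + q ∧ m'.reg 13 = j ∧
      m'.reg 14 = o + (L v).length ∧ I ((L v).take q) m') ?_ ?_ ?_ (by omega) ?_).weaken ?_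
    · rintro j m' ⟨q, hq, h1, h2, h3⟩
      exact ⟨h1, h2⟩
    · rintro j m' hj ⟨q, rfl, h1, h2, h3⟩
      have hq : q < (L v).length := by omega
      obtain ⟨hin, harr⟩ := hI _ _ h3
      have hld : m'.arr 1 (m'.reg 13) = ((L v)[q] : ℕ) := by
        rw [h1, ho, ← harr]
        exact hin.arr_adj v q hq
      refine load_seq ?_
      rw [hld]
      refine seq (hbody ((L v).take q) (L v)[q] ((L v).drop (q + 1)) m' ?_ h3) ?_
      · rw [← List.drop_eq_getElem_cons hq, List.take_append_drop]
      · rintro m'' ⟨h4, h5, h6⟩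
        refine incr ⟨q + 1, rfl, ?_, ?_, ?_⟩
        · simp [h4, h1, add_assoc]
        · simp [h5, h2]
        · rw [List.take_add_one, List.getElem?_eq_getElem hq]
          exact h6 _
    · rintro m' ⟨q, hq, -, -, h3⟩
      obtain rfl : (L v).length = q := by omega
      rw [List.take_length] at h3
      exact hend _ h3
    · exact ⟨0, rfl, by simp, by simp, by simpa using h0 _ _⟩
    · ring_nf; omega
  refine (load_seq <| copy_seq <| incr_seq <| load_seq (τ := (L v).length * (τ + 5) + 1)
    ?_).weaken (by omega)
  rw [Nat.add_sub_cancel_left] at key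
  convert key using 1
  simp only [Memory.reg_setReg, Memory.arr_setReg, hr1, if_true, if_false, hv, hm.arr_succ, ← ho]
  simp only [Memory.setReg]
  congr 1
  ext i
  by_cases h14 : i = 14 <;> simp [h14]

end Ht

end RAM

/-! ### The program and its deterministic subroutines -/

namespace RAM

open Function

/-- Colour each block with `0, 1, …` in the order of its vertices. -/
def initColors : Prog :=
  forLoop 8 0 <| .seq (.load 9 2 8) <| .seq (.load 11 4 9) <| .seq (.store 3 8 11) <|
    .seq (.incr 11) (.store 4 9 11)

/-- Store four times the maximum degree in register `4`. -/
def degreeBound : Prog :=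
  .seq (.const 4 0) <| forLoop 8 0 <| .seq (.const 11 0) <|
    .seq (scan 8 (.seq (.incr 11) <| .seq (.incr 11) <| .seq (.incr 11) (.incr 11))) <|
    .ite 4 11 (.copy 4 11) skip

/-- Array `5` receives at `i` the vertex of block `i` with the colour in register `6`. -/
def findColored : Prog :=
  forLoop 8 0 <| .seq (.load 9 2 8) <| .seq (.load 11 3 8) <| ifEq 11 6 (.store 5 9 8)

/-- Empty the lists of candidates and the transversal. -/
def clearBlocks : Prog := forLoop 9 1 <| .seq (.store 6 9 3) (.store 9 9 0)

/-- Collect for each block a list of candidates, of at most the length in register `4`. Array `6`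
holds the lengths, array `7` the first entries of the lists and array `8` the successors. -/
def findCandidates : Prog :=
  forLoop 8 0 <| .seq (.load 9 2 8) <| .seq (.load 10 5 9) <| .seq (.load 11 3 8) <|
    .seq (.const 12 0) <| .seq (scan 10 (.seq (.load 16 3 15) (ifEq 16 11 (.const 12 1)))) <|
    .seq (.load 17 6 9) <| .ite 3 12 skip <|
      .ite 17 4 (.seq (.load 18 7 9) <| .seq (.store 8 8 18) <| .seq (.store 7 9 8) <|
        .seq (.incr 17) (.store 6 9 17)) skip

/-- Make the vertex in register `5` the only candidate of the block in register `7`. -/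
def setSpecial : Prog := .seq (.store 7 7 5) <| .seq (.const 17 1) (.store 6 7 17)

/-- Push register `9` on the stack, which is held in array `10`, with its height in register `19`. -/
def push : Prog := .seq (.store 10 19 9) (.incr 19)

/-- Stack all blocks, the one in register `7` at the bottom. -/
def makeStack : Prog :=
  .seq (.const 19 0) <| .seq (.store 10 19 7) <| .seq (.incr 19) <|
    forLoop 9 1 (.ite 9 7 push (.ite 7 9 push skip))

/-- Pop a block from the stack to register `9` and load the number of its candidates. -/
def draw₁ : Prog := .seq (.decr 19) <| .seq (.load 9 10 19) (.load 17 6 9)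

/-- Register `8` receives the candidate of the block in register `9` at the position in register
`20`. -/
def draw₂ : Prog := .seq (.load 8 7 9) (forLoop 21 20 (.load 8 8 8))

/-- Choose the vertex in register `8`, if no chosen vertex is adjacent to it. -/
def tryVertex : Prog :=
  .seq (.copy 12 1) <|
    .seq (scan 8 (.seq (.load 22 2 15) <| .seq (.load 23 9 22) (ifEq 23 15 (.copy 12 22)))) <|
    .ite 12 1 (.seq (.store 9 12 0) <| .seq (.incr 19) <| .seq (.store 10 19 12) (.incr 19))
      (.store 9 9 8)

/-- The random walk on partial transversals. -/
def walk : Prog := .loop 3 19 <| .seq draw₁ <| .seq (.rand 20 17) (.seq draw₂ tryVertex)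

/-- Exchange the colours of the vertices in the arrays `5` and `9`. -/
def swapColors : Prog :=
  forLoop 9 1 <| .seq (.load 10 5 9) <| .seq (.load 8 9 9) <| .seq (.load 11 3 8) <|
    .seq (.store 3 10 11) (.store 3 8 6)

/-- Remove all conflicts of the vertex in register `5` with smaller vertices. -/
def phase : Prog :=
  .seq (.load 6 3 5) <| .seq (.load 7 2 5) <| .seq findColored <| .seq clearBlocks <|
    .seq findCandidates <| .seq setSpecial <| .seq makeStack <| .seq walk swapColors

/-- The program that finds a strong colouring. -/
def strongColoring : Prog :=
  .seq initColors <| .seq degreeBound <| .seq (.const 5 0) <| .seq (.ite 3 4 skip (.copy 5 0)) <|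
    .loop 5 0 (.seq phase (.incr 5))

section Spec

variable {n k : ℕ} {L : Fin n → List (Fin n)} {blk : Fin n → Fin k} {m : Memory}

/-- Array `4` counts, for each block, the vertices met so far, so a vertex receives its rank within
its block. -/
theorem initColors_spec (hm : HoldsInput L blk m) (h4 : m.arr 4 = fun _ => 0) :
    Ht m initColors (n * 13 + 3) fun m' => Same [8, 9, 11] [3, 4] m m' ∧
      ∀ v : Fin n, m'.arr 3 v = (Finset.univ.filter fun u => u < v ∧ blk u = blk v).card := by
  refine (Ht.forLoop (N := n) (τ := 10) (fun j m' => Same [8, 9, 11] [3, 4] m m' ∧ m'.reg 8 = j ∧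
    (∀ i : Fin k, m'.arr 4 i = (Finset.univ.filter fun u : Fin n => (u : ℕ) < j ∧ blk u = i).card) ∧
    ∀ v : Fin n, (v : ℕ) < j →
      m'.arr 3 v = (Finset.univ.filter fun u => u < v ∧ blk u = blk v).card) ?_ ?_ ?_ ?_).weaken ?_
  · rintro j m' ⟨hs, h, -⟩
    exact ⟨h, (hs.reg 0).trans hm.reg_n⟩
  · refine ⟨(Same.refl _ _ _).setReg, by simp, by simp [h4], by simp⟩
  · rintro j m' hj ⟨hs, h8, hcnt, hcol⟩
    have hin := hm.of_same hs
    set v : Fin n := ⟨j, hj⟩ with hv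
    have hb : m'.arr 2 j = blk v := hin.arr_blk v
    refine (Ht.load_seq <| Ht.load_seq <| Ht.store_seq <| Ht.incr_seq <| Ht.store
      ⟨?_, ?_, ?_, ?_⟩).weaken (by omega)
    · repeat' first | exact hs | refine Same.setReg ?_ | refine Same.setArr ?_
    · simp [h8]
    · intro i
      simp only [Memory.reg_setReg, Memory.arr_setReg, Memory.reg_setArr, Memory.arr_setArr]
      norm_num [h8, hb]
      simp only [update_apply, Fin.val_inj, hcnt]
      split_ifs with hi
      · subst hi
        rw [← Finset.card_insert_of_notMem (a := v) (by simp [hv])]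
        congr 1
        ext u
        simp only [Finset.mem_insert, Finset.mem_filter, Finset.mem_univ, true_and, Fin.ext_iff, hv]
        constructor
        · rintro (h | h)
          · refine ⟨by omega, ?_⟩
            exact congrArg (fun z => (blk z : ℕ)) (Fin.ext h)
          · exact ⟨by omega, h.2⟩
        · rintro ⟨h1, h2⟩
          by_cases h : (u : ℕ) = j
          · exact .inl h
          · exact .inr ⟨by omega, h2⟩
      · congr 1
        ext u
        simp only [Finset.mem_filter, Finset.mem_univ, true_and]
        constructor
        · rintro ⟨h1, h2⟩
          exact ⟨by omega, h2⟩
        · rintro ⟨h1, h2⟩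
          refine ⟨?_, h2⟩
          by_contra hc
          have : u = v := Fin.ext (by simp [hv]; omega)
          exact hi (by rw [← h2, this])
    · intro u hu
      simp only [Memory.reg_setReg, Memory.arr_setReg, Memory.reg_setArr, Memory.arr_setArr]
      norm_num [h8, hb]
      simp only [update_apply, hcnt]
      split_ifs with h
      · have : u = v := Fin.ext h
        subst this
        rfl
      · exact hcol u (by omega)
  · rintro m' ⟨hs, -, -, hcol⟩
    exact ⟨hs, fun v => hcol v v.2⟩
  · omega

/-- Four increments per neighbour replace a multiplication. The final disjunction gives the upper
bound that pins the register to four times the maximum degree. -/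
theorem degreeBound_spec (hm : HoldsInput L blk m) {d : ℕ} (hd : ∀ v, (L v).length ≤ d) :
    Ht m degreeBound (n * (d * 20 + 30) + 10) fun m' =>
      Same [4, 8, 11, 13, 14, 15] [] m m' ∧ (∀ v, 4 * (L v).length ≤ m'.reg 4) ∧
        (m'.reg 4 = 0 ∨ ∃ v, m'.reg 4 = 4 * (L v).length) := by
  refine (Ht.const_seq <| Ht.forLoop (N := n) (τ := d * 20 + 20) (fun j m' =>
    Same [4, 8, 11, 13, 14, 15] [] m m' ∧ m'.reg 8 = j ∧
    (∀ v : Fin n, (v : ℕ) < j → 4 * (L v).length ≤ m'.reg 4) ∧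
    (m'.reg 4 = 0 ∨ ∃ v, m'.reg 4 = 4 * (L v).length)) ?_ ?_ ?_ ?_).weaken ?_
  · rintro j m' ⟨hs, h, -⟩
    exact ⟨h, (hs.reg 0).trans hm.reg_n⟩
  · exact ⟨(Same.refl _ _ _).setReg.setReg, by simp, by simp, by simp⟩
  · rintro j m' hj ⟨hs, h8, h4, h4'⟩
    set v : Fin n := ⟨j, hj⟩ with hv
    have hs1 : Same [4, 8, 11, 13, 14, 15] [] m (m'.setReg 11 0) := hs.setReg
    refine (Ht.const_seq <| Ht.seq (τ' := 2) (R := fun m'' => Same [11, 13, 14, 15] [] m' m'' ∧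
      m''.reg 11 = 4 * (L v).length) ((Ht.scan (v := v) (τ := 7) (hm.of_same hs1)
      (by simp [h8, hv]) (by decide) (fun l m'' => Same [11, 13, 14, 15] [] m' m'' ∧
        m''.reg 11 = 4 * l.length) ?_ ?_ ?_ ?_)) ?_).weaken ?_
    · rintro l m'' ⟨hs', -⟩
      refine ⟨hm.of_same (hs.trans hs'), ?_⟩
      rw [hs'.arr 0]
      simp
    · intro a b
      exact ⟨(Same.refl _ _ _).setReg.setReg.setReg, by simp⟩
    · rintro l u l' m'' - ⟨hs', h⟩
      refine (Ht.incr_seq <| Ht.incr_seq <| Ht.incr_seq <| Ht.incr ⟨by simp, by simp, fun a => ⟨?_, ?_⟩⟩)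
      · repeat' first | exact hs' | refine Same.setReg ?_
      · simp [h]; omega
    · exact fun _ h => h
    · rintro m'' ⟨hs', h⟩
      refine Ht.ite (fun hlt => Ht.copy ⟨?_, ?_, ?_, ?_⟩) fun hle => Ht.skip ⟨?_, ?_, ?_, ?_⟩
      · exact ((hs.trans hs').setReg).setReg
      · simp [hs'.reg 8, h8]
      · intro u hu
        rw [hs'.reg 4] at hlt
        by_cases huv : u = v
        · subst huv; simp [h]
        · have := h4 u (by have : (u : ℕ) ≠ j := fun e => huv (Fin.ext e)
                           omega)
          simp
          omega
      · exact .inr ⟨v, by simp [h]⟩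
      · exact (hs.trans hs').setReg
      · simp [hs'.reg 8, h8]
      · intro u hu
        rw [hs'.reg 4] at hle
        by_cases huv : u = v
        · subst huv; simp [hs'.reg 4]; omega
        · have := h4 u (by have : (u : ℕ) ≠ j := fun e => huv (Fin.ext e)
                           omega)
          simpa [hs'.reg 4] using this
      · simpa [hs'.reg 4] using h4'
    · have := hd v
      nlinarith
  · rintro m' ⟨hs, -, h1, h2⟩
    exact ⟨hs, fun v => h1 v v.2, h2⟩
  · ring_nf; omega

/-- Injectivity on blocks ensures that an entry, once written, is not overwritten by another vertex.
-/
theorem findColored_spec (hm : HoldsInput L blk m) {col : Fin n → ℕ} (hcol : ∀ v : Fin n, m.arr 3 v = col v)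
    (hinj : ∀ u v, blk u = blk v → col u = col v → u = v) :
    Ht m findColored (n * 11 + 3) fun m' => Same [8, 9, 11] [5] m m' ∧
      ∀ v : Fin n, col v = m.reg 6 → m'.arr 5 (blk v) = v := by
  refine (Ht.forLoop (N := n) (τ := 8) (fun j m' => Same [8, 9, 11] [5] m m' ∧ m'.reg 8 = j ∧
    ∀ v : Fin n, (v : ℕ) < j → col v = m.reg 6 → m'.arr 5 (blk v) = v) ?_ ?_ ?_ ?_).weaken ?_
  · rintro j m' ⟨hs, h, -⟩
    exact ⟨h, (hs.reg 0).trans hm.reg_n⟩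
  · refine ⟨(Same.refl _ _ _).setReg, by simp, by simp⟩
  · rintro j m' hj ⟨hs, h8, hx⟩
    have hin := hm.of_same hs
    set v : Fin n := ⟨j, hj⟩ with hv
    have hb : m'.arr 2 j = blk v := hin.arr_blk v
    have hc : m'.arr 3 j = col v := (congrFun (hs.arr 3) j).trans (hcol v)
    have h6 := hs.reg 6
    refine (Ht.load_seq <| Ht.load_seq <| Ht.ifEq (τ := 1) (fun h => Ht.store ⟨?_, ?_, ?_⟩)
      fun h => ⟨?_, ?_, ?_⟩).weaken (by omega)
    · repeat' first | exact hs | refine Same.setReg ?_ | refine Same.setArr ?_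
    · simp [h8]
    · intro u hu huc
      simp [h8, hb, hc, h6] at h
      simp only [Memory.reg_setReg, Memory.arr_setReg, Memory.reg_setArr, Memory.arr_setArr]
      norm_num [h8, hb]
      simp only [update_apply]
      split_ifs with hi
      · have : u = v := hinj _ _ (Fin.ext hi) (by omega)
        simp [this, hv]
      · refine hx u ?_ huc
        have : (u : ℕ) ≠ j := fun e => hi (by rw [show u = v from Fin.ext e])
        omega
    · repeat' first | exact hs | refine Same.setReg ?_
    · simp [h8]
    · intro u hu huc
      simp [h8, hb, hc, h6] at h
      simp only [Memory.arr_setReg]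
      refine hx u ?_ huc
      have : (u : ℕ) ≠ j := fun e => h (by rw [← huc, show u = v from Fin.ext e])
      omega
  · rintro m' ⟨hs, -, h⟩
    exact ⟨hs, fun v => h v v.2⟩
  · omega

theorem clearBlocks_spec (hm : HoldsInput L blk m) :
    Ht m clearBlocks (k * 6 + 3) fun m' => Same [9] [6, 9] m m' ∧
      ∀ i : Fin k, m'.arr 6 i = 0 ∧ m'.arr 9 i = n := by
  refine (Ht.forLoop (N := k) (τ := 3) (fun j m' => Same [9] [6, 9] m m' ∧ m'.reg 9 = j ∧
    ∀ i : Fin k, (i : ℕ) < j → m'.arr 6 i = 0 ∧ m'.arr 9 i = n) ?_ ?_ ?_ ?_).weaken ?_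
  · rintro j m' ⟨hs, h, -⟩
    exact ⟨h, (hs.reg 1).trans hm.reg_k⟩
  · refine ⟨(Same.refl _ _ _).setReg, by simp, by simp⟩
  · rintro j m' hj ⟨hs, h9, hx⟩
    have hin := hm.of_same hs
    refine (Ht.store_seq <| Ht.store ⟨?_, ?_, ?_⟩).weaken (by omega)
    · repeat' first | exact hs | refine Same.setReg ?_ | refine Same.setArr ?_
    · simp [h9]
    · intro i hi
      by_cases hij : (i : ℕ) = j
      · simp [h9, hij, hin.reg_zero, hin.reg_n]
      · simpa [h9, hij] using hx i (by omega)
  · rintro m' ⟨hs, -, h⟩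
    exact ⟨hs, fun v => h v v.2⟩
  · omega

end Spec

end RAM

/-! ### Linked lists of candidates and the stack -/

namespace RAM

open Function

/-- Following `next` from `h` runs through `l`. -/
def IsLinked {n : ℕ} (next : ℕ → ℕ) : ℕ → List (Fin n) → Prop
  | _, [] => True
  | h, w :: l => h = w ∧ IsLinked next (next w) l

theorem IsLinked.update {n : ℕ} {next : ℕ → ℕ} {h : ℕ} {l : List (Fin n)} (hl : IsLinked next h l)
    {w : Fin n} (hw : w ∉ l) (v : ℕ) : IsLinked (update next w v) h l := by
  induction l generalizing h with
  | nil => trivial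
  | cons a l ih =>
    rw [List.mem_cons, not_or] at hw
    refine ⟨hl.1, ?_⟩
    rw [Function.update_of_ne (fun e => hw.1 (Fin.ext e).symm)]
    exact ih hl.2 hw.2

theorem IsLinked.iterate {n : ℕ} {next : ℕ → ℕ} {h : ℕ} {l : List (Fin n)} (hl : IsLinked next h l)
    {r : ℕ} (hr : r < l.length) : next^[r] h = l[r] := by
  induction l generalizing h r with
  | nil => simp at hr
  | cons a l ih =>
    obtain ⟨rfl, hl⟩ := hl
    cases r with
    | zero => rfl
    | succ r =>
      rw [Function.iterate_succ_apply]
      exact ih hl _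

/-- `l` lists vertices `w < j` of the block `i` with the property `P`: all of them or `D` many. -/
structure IsCandList {n k : ℕ} (blk : Fin n → Fin k) (P : Fin n → Prop) (D j : ℕ) (i : Fin k)
    (l : List (Fin n)) : Prop where
  nodup : l.Nodup
  mem : ∀ w ∈ l, (w : ℕ) < j ∧ blk w = i ∧ P w
  length_le : l.length ≤ D
  complete : l.length < D → ∀ w : Fin n, (w : ℕ) < j → blk w = i → P w → w ∈ l

section IsCandList

variable {n k : ℕ} {blk : Fin n → Fin k} {P : Fin n → Prop} {D j : ℕ} {i : Fin k}
  {l : List (Fin n)}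

/-- The vertex `j` may be omitted when it lies in another block, violates `P`, or finds the list
full; in the last case completeness is void. -/
theorem IsCandList.succ (h : IsCandList blk P D j i l)
    (hw : ∀ w : Fin n, (w : ℕ) = j → blk w = i → P w → D ≤ l.length) :
    IsCandList blk P D (j + 1) i l where
  nodup := h.nodup
  mem w hw := ⟨(h.mem w hw).1.trans (Nat.lt_succ_self j), (h.mem w hw).2⟩
  length_le := h.length_le
  complete hl w h1 h2 h3 := by
    by_cases hj : (w : ℕ) = j
    · exact absurd (hw w hj h2 h3) (not_le.2 hl)
    · exact h.complete hl w (by omega) h2 h3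

theorem IsCandList.cons (h : IsCandList blk P D j i l) {w : Fin n} (hw : (w : ℕ) = j)
    (hb : blk w = i) (hP : P w) (hl : l.length < D) : IsCandList blk P D (j + 1) i (w :: l) where
  nodup := List.nodup_cons.2 ⟨fun hm => by have := (h.mem w hm).1; omega, h.nodup⟩
  mem u hu := by
    rcases List.mem_cons.1 hu with rfl | hu
    · exact ⟨by omega, hb, hP⟩
    · exact ⟨(h.mem u hu).1.trans (Nat.lt_succ_self j), (h.mem u hu).2⟩
  length_le := hl
  complete _ u h1 h2 h3 := by
    by_cases hj : (u : ℕ) = j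
    · exact List.mem_cons.2 (.inl (Fin.ext (hj.trans hw.symm)))
    · exact List.mem_cons.2 (.inr (h.complete hl u (by omega) h2 h3))

end IsCandList

/-- The memory holds the lists `cl` of candidates: arrays `6`, `7`, `8` hold their lengths, their
heads, and the successors. -/
def HoldsCands {n k : ℕ} (cl : Fin k → List (Fin n)) (m : Memory) : Prop :=
  ∀ i : Fin k, m.arr 6 i = (cl i).length ∧ IsLinked (m.arr 8) (m.arr 7 i) (cl i)

section Spec

variable {n k : ℕ} {L : Fin n → List (Fin n)} {blk : Fin n → Fin k} {m : Memory}

theorem findCandidates_spec (hm : HoldsInput L blk m) {d : ℕ} (hd : ∀ v, (L v).length ≤ d)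
    {col : Fin n → ℕ} (hcol : ∀ v : Fin n, m.arr 3 v = col v)
    {x : Fin k → Fin n} (hx : ∀ i : Fin k, m.arr 5 i = x i) (h6 : ∀ i : Fin k, m.arr 6 i = 0) :
    Ht m findCandidates (n * (d * 20 + 50) + 3) fun m' =>
      Same [8, 9, 10, 11, 12, 13, 14, 15, 16, 17, 18] [6, 7, 8] m m' ∧
      ∃ cl : Fin k → List (Fin n), HoldsCands cl m' ∧
        ∀ i, IsCandList blk (fun w => ∀ u ∈ L (x (blk w)), col u ≠ col w) (m.reg 4) n i (cl i) := by
  set P : Fin n → Prop := fun w => ∀ u ∈ L (x (blk w)), col u ≠ col w with hP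
  refine (Ht.forLoop (N := n) (τ := d * 20 + 40) (fun j m' =>
    Same [8, 9, 10, 11, 12, 13, 14, 15, 16, 17, 18] [6, 7, 8] m m' ∧ m'.reg 8 = j ∧
    ∃ cl : Fin k → List (Fin n), HoldsCands cl m' ∧
      ∀ i, IsCandList blk P (m.reg 4) j i (cl i)) ?_ ?_ ?_ ?_).weaken ?_
  · rintro j m' ⟨hs, h, -⟩
    exact ⟨h, (hs.reg 0).trans hm.reg_n⟩
  · refine ⟨(Same.refl _ _ _).setReg, by simp, fun _ => [], fun i => ⟨h6 i, trivial⟩,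
      fun i => ⟨by simp, by simp, by simp, by simp⟩⟩
  · rintro j m' hj ⟨hs, h8, cl, hcl, hcand⟩
    have hin := hm.of_same hs
    set w : Fin n := ⟨j, hj⟩ with hw
    have hb : m'.arr 2 j = blk w := hin.arr_blk w
    have hc : m'.arr 3 j = col w := (congrFun (hs.arr 3) j).trans (hcol w)
    have hxw : m'.arr 5 (blk w) = x (blk w) := (congrFun (hs.arr 5) _).trans (hx _)
    have hpre : Same [9, 10, 11, 12] [] m' ((((m'.setReg 9 (m'.arr 2 (m'.reg 8))).setReg 10
      (m'.arr 5 (blk w))).setReg 11 (col w)).setReg 12 0) := by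
      repeat' first | exact Same.refl _ _ _ | refine Same.setReg ?_
    refine (Ht.load_seq <| Ht.load_seq <| Ht.load_seq <| Ht.const_seq ?_).weaken
      (show (1 + ((L (x (blk w))).length * 12 + 9) + 13) + 2 + 2 + 2 + 2 ≤ _ by
        have := hd (x (blk w))
        omega)
    simp only [Memory.reg_setReg, Memory.arr_setReg]
    norm_num only [if_true, if_false, h8, hb, hc]
    rw [h8, hb] at hpre
    refine Ht.seq (R := fun m'' => Same [9, 10, 11, 12, 13, 14, 15, 16] [] m' m'' ∧
      m''.reg 9 = blk w ∧ ((m''.reg 12 = 0 ∧ P w) ∨ (m''.reg 12 = 1 ∧ ¬ P w)))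
      ((Ht.scan (v := x (blk w)) (τ := 7) (hin.of_same hpre) (by simp [hxw]) (by decide)
      (fun l m'' => Same [9, 10, 11, 12, 13, 14, 15, 16] [] m' m'' ∧
      m''.reg 9 = blk w ∧ m''.reg 11 = col w ∧ ((m''.reg 12 = 0 ∧ ∀ u ∈ l, col u ≠ col w) ∨
        (m''.reg 12 = 1 ∧ ∃ u ∈ l, col u = col w))) ?_ ?_ ?_ ?_)) ?_
    · rintro l m'' ⟨hs', -⟩
      refine ⟨hin.of_same hs', ?_⟩
      rw [hs'.arr 0]
      simp
    · intro a b
      exact ⟨hpre.mono.setReg.setReg, by simp, by simp, by simp⟩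
    · rintro l u l' m'' - ⟨hs', h9, h11, h⟩
      have hcu : m''.arr 3 u = col u :=
        (congrFun (hs'.arr 3) _).trans ((congrFun (hs.arr 3) _).trans (hcol u))
      refine (Ht.load_seq <| Ht.ifEq (τ := 1)
        (fun heq => Ht.const ⟨by simp, by simp, fun a => ⟨?_, ?_, ?_, ?_⟩⟩)
        fun hne => ⟨by simp, by simp, fun a => ⟨?_, ?_, ?_, ?_⟩⟩).weaken (by omega)
      · repeat' first | exact hs' | refine Same.setReg ?_
      · simp [h9]
      · simp [h11]
      · simp [hcu, h11] at heq
        simp [heq]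
      · repeat' first | exact hs' | refine Same.setReg ?_
      · simp [h9]
      · simp [h11]
      · simp [hcu, h11] at hne
        rcases h with ⟨h, h'⟩ | ⟨h, v, hv, hv'⟩
        · refine .inl ⟨by simp [h], fun v hv => ?_⟩
          rcases List.mem_append.1 hv with hv | hv
          · exact h' v hv
          · rw [List.mem_singleton.1 hv]; exact hne
        · exact .inr ⟨by simp [h], v, by simp [hv], hv'⟩
    · rintro m'' ⟨h1, h2, -, h⟩
      refine ⟨h1, h2, h.imp_right fun h => ⟨h.1, ?_⟩⟩
      obtain ⟨u, hu, hu'⟩ := h.2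
      exact fun hPw => hPw u hu hu'
    · rintro m'' ⟨hs', h9, h⟩
      have h8' : m''.reg 8 = j := (hs'.reg 8).trans h8
      have h3 : m''.reg 3 = 0 := (hin.of_same hs').reg_zero
      have h4 : m''.reg 4 = m.reg 4 := (hs'.reg 4).trans (hs.reg 4)
      have hlen : m''.arr 6 (blk w) = (cl (blk w)).length := by
        rw [hs'.arr 6]; exact (hcl _).1
      have hs2 := hs.trans (R' := [9, 10, 11, 12, 13, 14, 15, 16]) (A' := []) hs'
      have hcl' : HoldsCands cl m'' := by
        intro i
        rw [hs'.arr 6, hs'.arr 7, hs'.arr 8]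
        exact hcl i
      refine (Ht.load_seq (τ := 11) ?_)
      rw [h9, hlen]
      refine (Ht.ite (τ := 10) (fun hlt => (Ht.skip ?_).weaken (by omega)) fun hle => ?_)
      -- Register `3` always holds 0, so the comparison tests the conflict flag in register `12`.
      · simp [h3] at hlt
        have hnP : ¬ P w := by
          rcases h with h | h
          · omega
          · exact h.2
        refine ⟨?_, by simp [h8'], cl, hcl', fun i => (hcand i).succ fun v hv _ hPv => ?_⟩
        · repeat' first | exact hs2 | refine Same.setReg ?_
        · rw [show v = w from Fin.ext hv] at hPv
          exact absurd hPv hnP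
      · simp [h3] at hle
        have hPw : P w := by
          rcases h with h | h
          · exact h.2
          · omega
        refine (Ht.ite (τ := 9) (fun hlt => (Ht.load_seq <| Ht.store_seq <| Ht.store_seq <|
          Ht.incr_seq <| Ht.store ?_).weaken (by omega)) fun hle => (Ht.skip ?_).weaken (by omega)).weaken
          (by omega)
        · simp [h4] at hlt
          refine ⟨?_, by simp [h8'], update cl (blk w) (w :: cl (blk w)), fun i => ?_, fun i => ?_⟩
          · repeat' first | exact hs2 | refine Same.setReg ?_ | refine Same.setArr ?_
          -- The successor entry of `w` may be overwritten because `w` is not yet in any list.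
          · have hwn : ∀ i, w ∉ cl i := fun i hi => by
              have := ((hcand i).mem w hi).1
              simp [hw] at this
            have hlink := (hcl' i).2
            simp only [Memory.reg_setReg, Memory.arr_setReg, Memory.reg_setArr, Memory.arr_setArr]
            norm_num [h8', h9]
            by_cases hi : i = blk w
            · subst hi
              simp only [update_self, List.length_cons, true_and]
              refine ⟨rfl, ?_⟩
              change IsLinked _ (update (m''.arr 8) j _ j) _
              rw [update_self]
              exact hlink.update (hwn _) _
            · have hi' : (i : ℕ) ≠ blk w := fun e => hi (Fin.ext e)
              rw [update_of_ne hi', update_of_ne hi', update_of_ne hi]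
              exact ⟨(hcl' i).1, hlink.update (hwn i) _⟩
          · by_cases hi : i = blk w
            · subst hi
              rw [update_self]
              exact (hcand _).cons rfl rfl hPw hlt
            · rw [update_of_ne hi]
              refine (hcand i).succ fun v hv hvi _ => ?_
              rw [show v = w from Fin.ext hv] at hvi
              exact absurd hvi.symm hi
        · simp [h4] at hle
          refine ⟨?_, by simp [h8'], cl, hcl', fun i => (hcand i).succ fun v hv hvi _ => ?_⟩
          · repeat' first | exact hs2 | refine Same.setReg ?_
          · rw [show v = w from Fin.ext hv] at hvi
            subst hvi
            exact hle
  · rintro m' ⟨hs, -, h⟩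
    exact ⟨hs, h⟩
  · ring_nf; omega

/-- The successors in array `8` can stay as they are: a list of length one follows none. -/
theorem setSpecial_spec {cl : Fin k → List (Fin n)} (hcl : HoldsCands cl m) {t : Fin n} {z : Fin k}
    (h5 : m.reg 5 = t) (h7 : m.reg 7 = z) :
    Ht m setSpecial 5 fun m' => Same [17] [6, 7] m m' ∧ HoldsCands (update cl z [t]) m' := by
  refine (Ht.store_seq <| Ht.const_seq <| Ht.store ⟨?_, fun i => ?_⟩)
  · repeat' first | exact Same.refl _ _ _ | refine Same.setReg ?_ | refine Same.setArr ?_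
  · simp only [Memory.reg_setReg, Memory.arr_setReg, Memory.reg_setArr, Memory.arr_setArr]
    norm_num [h5, h7]
    by_cases hi : i = z
    · subst hi
      simp [IsLinked]
    · have hi' : (i : ℕ) ≠ z := fun e => hi (Fin.ext e)
      rw [update_of_ne hi', update_of_ne hi', update_of_ne hi]
      exact hcl i

/-- The array `f` holds the stack `σ`, whose top is the first entry. -/
def IsStack {k : ℕ} (f : ℕ → ℕ) : List (Fin k) → Prop
  | [] => True
  | i :: σ => f σ.length = i ∧ IsStack f σ

theorem IsStack.update {k : ℕ} {f : ℕ → ℕ} {σ : List (Fin k)} (h : IsStack f σ) {p : ℕ}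
    (hp : σ.length ≤ p) (v : ℕ) : IsStack (update f p v) σ := by
  induction σ with
  | nil => trivial
  | cons i σ ih =>
    rw [List.length_cons] at hp
    refine ⟨?_, ih h.2 (by omega)⟩
    rw [update_of_ne (by omega)]
    exact h.1

theorem makeStack_spec (hm : HoldsInput L blk m) {z : Fin k} (h7 : m.reg 7 = z) :
    Ht m makeStack (k * 20 + 20) fun m' => Same [9, 19] [10] m m' ∧
      ∃ σ : List (Fin k), (σ ++ [z]).Nodup ∧ (∀ i, i ∈ σ ++ [z]) ∧ m'.reg 19 = (σ ++ [z]).length ∧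
        IsStack (m'.arr 10) (σ ++ [z]) := by
  refine (Ht.const_seq <| Ht.store_seq <| Ht.incr_seq <| Ht.forLoop (N := k) (τ := 5) (fun j m' =>
    Same [9, 19] [10] m m' ∧ m'.reg 9 = j ∧
      ∃ σ : List (Fin k), (σ ++ [z]).Nodup ∧ (∀ i, i ∈ σ → (i : ℕ) < j) ∧
        (∀ i : Fin k, (i : ℕ) < j → i ∈ σ ++ [z]) ∧
        m'.reg 19 = (σ ++ [z]).length ∧ IsStack (m'.arr 10) (σ ++ [z])) ?_ ?_ ?_ ?_).weaken ?_
  · rintro j m' ⟨hs, h, -⟩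
    exact ⟨h, (hs.reg 1).trans hm.reg_k⟩
  · refine ⟨?_, by simp, [], by simp, by simp, by simp, by simp, ?_⟩
    · repeat' first | exact Same.refl _ _ _ | refine Same.setReg ?_ | refine Same.setArr ?_
    · simp [IsStack, h7]
  · rintro j m' hj ⟨hs, h9, σ, hnd, hlt, hall, h19, hst⟩
    have h7' : m'.reg 7 = z := (hs.reg 7).trans h7
    have hpush : j ≠ z → Ht m' push 3 fun m' => (fun m' =>
        Same [9, 19] [10] m m' ∧ m'.reg 9 = j + 1 ∧
      ∃ σ : List (Fin k), (σ ++ [z]).Nodup ∧ (∀ i, i ∈ σ → (i : ℕ) < j + 1) ∧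
        (∀ i : Fin k, (i : ℕ) < j + 1 → i ∈ σ ++ [z]) ∧
        m'.reg 19 = (σ ++ [z]).length ∧ IsStack (m'.arr 10) (σ ++ [z]))
          (m'.setReg 9 (m'.reg 9 + 1)) := by
      intro hjz
      refine (Ht.store_seq <| Ht.incr ⟨?_, by simp [h9], ⟨j, hj⟩ :: σ, ?_, ?_, ?_, ?_, ?_⟩)
      · repeat' first | exact hs | refine Same.setReg ?_ | refine Same.setArr ?_
      · rw [List.cons_append, List.nodup_cons]
        refine ⟨fun h => ?_, hnd⟩
        rcases List.mem_append.1 h with h | h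
        · exact absurd (hlt _ h) (lt_irrefl j)
        · exact hjz (congrArg Fin.val (List.mem_singleton.1 h))
      · intro i hi
        rcases List.mem_cons.1 hi with rfl | hi
        · exact Nat.lt_succ_self j
        · exact (hlt i hi).trans (Nat.lt_succ_self j)
      · intro i hi
        rw [List.cons_append, List.mem_cons]
        by_cases hij : (i : ℕ) = j
        · exact .inl (Fin.ext hij)
        · exact .inr (hall i (by omega))
      · simp [h19]
      · simp only [Memory.reg_setReg, Memory.arr_setReg, Memory.reg_setArr, Memory.arr_setArr]
        norm_num [h9, h19]
        refine ⟨by simp, ?_⟩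
        exact hst.update (by simp) _
    refine (Ht.ite (τ := 4) (fun h => ?_) fun h => Ht.ite (τ := 3) (fun h' => ?_) fun h' => ?_)
    · exact (hpush (by omega)).weaken (by omega)
    · exact (hpush (by omega))
    · refine (Ht.skip ⟨hs.setReg, by simp [h9], σ, hnd, fun i hi => (hlt i hi).trans
        (Nat.lt_succ_self j), fun i hi => ?_, by simp [h19], by simpa using hst⟩).weaken (by omega)
      by_cases hij : (i : ℕ) = j
      · rw [show i = z from Fin.ext (by omega)]
        simp
      · exact hall i (by omega)
  · rintro m' ⟨hs, -, σ, h1, h2, h3, h4, h5⟩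
    exact ⟨hs, σ, h1, fun i => h3 i i.2, h4, h5⟩
  · omega

end Spec

end RAM

/-! ### The walk on the machine and its expected cost -/

namespace RAM

open Function

open scoped ENNReal NNReal

section Walk

variable {n k : ℕ}

/-- The block of the last neighbour of `w` in `l` that is chosen by `I`. -/
def lastConflict (blk : Fin n → Fin k) (I : Fin k → Option (Fin n)) (l : List (Fin n)) :
    Option (Fin k) :=
  l.foldl (fun f u => if I (blk u) = some u then some (blk u) else f) none

theorem lastConflict_concat (blk : Fin n → Fin k) (I : Fin k → Option (Fin n)) (l : List (Fin n))
    (u : Fin n) : lastConflict blk I (l ++ [u]) =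
      if I (blk u) = some u then some (blk u) else lastConflict blk I l := by
  simp [lastConflict, List.foldl_append]

theorem exists_of_lastConflict_eq_some {blk : Fin n → Fin k} {I : Fin k → Option (Fin n)}
    {l : List (Fin n)} {i : Fin k} (h : lastConflict blk I l = some i) :
    ∃ u ∈ l, I i = some u := by
  induction l using List.reverseRecOn with
  | nil => simp [lastConflict] at h
  | append_singleton l u ih =>
    rw [lastConflict_concat] at h
    split_ifs at h with hu
    · obtain rfl := Option.some.inj h
      exact ⟨u, by simp, hu⟩
    · obtain ⟨v, hv, hv'⟩ := ih h
      exact ⟨v, by simp [hv], hv'⟩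

theorem ne_some_of_lastConflict_eq_none {blk : Fin n → Fin k} {I : Fin k → Option (Fin n)}
    {l : List (Fin n)} (h : lastConflict blk I l = none) {u : Fin n} (hu : u ∈ l) :
    I (blk u) ≠ some u := by
  induction l using List.reverseRecOn with
  | nil => simp at hu
  | append_singleton l v ih =>
    rw [lastConflict_concat] at h
    split_ifs at h with hv
    rcases List.mem_append.1 hu with hu | hu
    · exact ih h hu
    · rwa [List.mem_singleton.1 hu]

/-- The memory holds the state of the walk with stack `σ` and chosen vertices `I`; `m₀` is the
memory at the beginning of the walk. -/
structure IsWalkState (G : SimpleGraph (Fin n)) (cl : Fin k → List (Fin n)) (m₀ : Memory)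
    (σ : List (Fin k)) (I : Fin k → Option (Fin n)) (m : Memory) : Prop where
  same : Same [8, 9, 12, 13, 14, 15, 17, 19, 20, 21, 22, 23] [9, 10] m₀ m
  height : m.reg 19 = σ.length
  stack : IsStack (m.arr 10) σ
  chosen : ∀ i : Fin k, m.arr 9 i = (I i).elim n Fin.val
  full : ∀ i, i ∈ σ ∨ ∃ w, I i = some w
  mem : ∀ i w, I i = some w → w ∈ cl i
  indep : ∀ i j u w, I i = some u → I j = some w → ¬ G.Adj u w

/-- The state of the walk after the block `j` on top of the stack has drawn `w`. -/
def IsNextState (G : SimpleGraph (Fin n)) (cl : Fin k → List (Fin n)) (L : Fin n → List (Fin n))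
    (blk : Fin n → Fin k) (m₀ : Memory) (j : Fin k) (σ : List (Fin k))
    (I : Fin k → Option (Fin n)) (w : Fin n) (m : Memory) : Prop :=
  match lastConflict blk I (L w) with
  | none => IsWalkState G cl m₀ σ (update I j (some w)) m
  | some i => IsWalkState G cl m₀ (i :: j :: σ) (update I i none) m

variable {G : SimpleGraph (Fin n)} {L : Fin n → List (Fin n)} {blk : Fin n → Fin k}
  {cl : Fin k → List (Fin n)} {m₀ m : Memory}

/-- The number `n`, which is no vertex, encodes a block without chosen vertex; comparing array
entries therefore compares options faithfully. -/
theorem elim_eq_val_iff (o : Option (Fin n)) (u : Fin n) :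
    o.elim n Fin.val = (u : ℕ) ↔ o = some u := by
  cases o with
  | none => simpa using u.2.ne'
  | some v => simp [Fin.ext_iff]

/-- Register `12` starts with `k`, which is no block, and ends with the last conflicting block, if
any. Deleting a vertex keeps independence; `w` is added only when no chosen vertex is adjacent to
it. -/
theorem tryVertex_spec (hm : HoldsInput L blk m₀) (hL : ∀ v u, u ∈ L v ↔ G.Adj v u) {d : ℕ}
    (hd : ∀ v, (L v).length ≤ d) (hblk : ∀ i, ∀ w ∈ cl i, blk w = i)
    {j : Fin k} {σ : List (Fin k)} {I : Fin k → Option (Fin n)} {w : Fin n} (hw : w ∈ cl j)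
    (same : Same [8, 9, 12, 13, 14, 15, 17, 19, 20, 21, 22, 23] [9, 10] m₀ m)
    (h8 : m.reg 8 = w) (h9 : m.reg 9 = j) (height : m.reg 19 = σ.length)
    (stack : IsStack (m.arr 10) (j :: σ))
    (chosen : ∀ i : Fin k, m.arr 9 i = (I i).elim n Fin.val)
    (full : ∀ i, i ∈ j :: σ ∨ ∃ w, I i = some w)
    (mem : ∀ i w, I i = some w → w ∈ cl i)
    (indep : ∀ i j u w, I i = some u → I j = some w → ¬ G.Adj u w) :
    Ht m tryVertex (d * 13 + 25) (IsNextState G cl L blk m₀ j σ I w) := by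
  have hk : m.reg 1 = k := (same.reg 1).trans hm.reg_k
  have hn : m.reg 0 = n := (same.reg 0).trans hm.reg_n
  have hin := hm.of_same same
  have h1 : Same [12, 13, 14, 15, 22, 23] [] m (m.setReg 12 (m.reg 1)) := (Same.refl _ _ _).setReg
  refine (Ht.copy_seq <| Ht.seq (τ' := 8) (R := fun m' => Same [12, 13, 14, 15, 22, 23] [] m m' ∧
    m'.reg 12 = (lastConflict blk I (L w)).elim k Fin.val) ((Ht.scan (v := w) (τ := 8)
      (hin.of_same h1) (by simp [h8]) (by decide) (fun l m' =>
      Same [12, 13, 14, 15, 22, 23] [] m m' ∧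
    m'.reg 12 = (lastConflict blk I l).elim k Fin.val) ?_ ?_ ?_ (fun _ => id))) ?_).weaken ?_
  · rintro l m' ⟨hs, -⟩
    refine ⟨hin.of_same hs, ?_⟩
    rw [hs.arr 0]
    simp
  · intro a b
    exact ⟨h1.setReg.setReg, by simp [lastConflict, hk]⟩
  · rintro l u l' m' - ⟨hs, h12⟩
    have hb : m'.arr 2 u = blk u := (hin.of_same hs).arr_blk u
    have hI : m'.arr 9 (blk u) = (I (blk u)).elim n Fin.val := by rw [hs.arr 9]; exact chosen _
    refine (Ht.load_seq <| Ht.load_seq <| Ht.ifEq (τ := 1)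
      (fun heq => Ht.copy ⟨by simp, by simp, fun a => ⟨?_, ?_⟩⟩)
      fun hne => ⟨by simp, by simp, fun a => ⟨?_, ?_⟩⟩).weaken (by omega)
    · repeat' first | exact hs | refine Same.setReg ?_
    · simp [hb, hI, elim_eq_val_iff] at heq
      simp [lastConflict_concat, heq, hb]
    · repeat' first | exact hs | refine Same.setReg ?_
    · simp [hb, hI, elim_eq_val_iff] at hne
      simp [lastConflict_concat, hne, h12]
  · rintro m' ⟨hs, h12⟩
    have hk' : m'.reg 1 = k := (hs.reg 1).trans hk
    have hn' : m'.reg 0 = n := (hs.reg 0).trans hn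
    have h8' : m'.reg 8 = w := (hs.reg 8).trans h8
    have h9' : m'.reg 9 = j := (hs.reg 9).trans h9
    have h19' : m'.reg 19 = σ.length := (hs.reg 19).trans height
    have hst : IsStack (m'.arr 10) (j :: σ) := by rw [hs.arr 10]; exact stack
    have hch : ∀ i : Fin k, m'.arr 9 i = (I i).elim n Fin.val := by rw [hs.arr 9]; exact chosen
    have hs' := same.trans hs
    refine Ht.ite (τ := 7) (fun hlt => (Ht.store_seq <| Ht.incr_seq <| Ht.store_seq <|
      Ht.incr ?_)) fun hle => (Ht.store ?_).weaken (by omega)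
    · obtain ⟨i, hi⟩ : ∃ i, lastConflict blk I (L w) = some i := by
        refine Option.ne_none_iff_exists'.1 fun h => ?_
        rw [h12, hk', h] at hlt
        exact lt_irrefl _ hlt
      obtain ⟨u, hu, hIu⟩ := exists_of_lastConflict_eq_some hi
      rw [IsNextState, hi]
      rw [hi] at h12
      refine ⟨?_, by simp [h19'], ?_, fun i' => ?_, fun i' => ?_, fun i' w' hI' => ?_, ?_⟩
      · repeat' first | exact hs' | refine Same.setReg ?_ | refine Same.setArr ?_
      · simp only [Memory.reg_setReg, Memory.arr_setReg, Memory.reg_setArr, Memory.arr_setArr]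
        norm_num [h19', h12]
        exact ⟨by simp, hst.update (by simp) _⟩
      · simp only [Memory.reg_setReg, Memory.arr_setReg, Memory.reg_setArr, Memory.arr_setArr]
        norm_num [h12, hn']
        by_cases hii : i' = i
        · subst hii; simp
        · rw [update_of_ne (fun e => hii (Fin.ext e)), update_of_ne hii]
          exact hch i'
      · by_cases hii : i' = i
        · subst hii; simp
        · rw [update_of_ne hii]
          exact (full i').imp_left fun h => List.mem_cons_of_mem _ h
      · by_cases hii : i' = i
        · subst hii; simp at hI'
        · rw [update_of_ne hii] at hI'
          exact mem _ _ hI'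
      · intro a b ua ub ha hb
        have haa : I a = some ua := by
          by_cases hai : a = i
          · subst hai; simp at ha
          · rwa [update_of_ne hai] at ha
        have hbb : I b = some ub := by
          by_cases hbi : b = i
          · subst hbi; simp at hb
          · rwa [update_of_ne hbi] at hb
        exact indep a b ua ub haa hbb
    · have hi : lastConflict blk I (L w) = none := by
        rcases h : lastConflict blk I (L w) with _ | i
        · rfl
        · rw [h12, hk', h] at hle
          exact absurd hle (not_le.2 i.2)
      rw [IsNextState, hi]
      -- A vertex chosen for `a` lies in `a`, so the scan finds every chosen neighbour by looking up
      -- its own block.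
      have hno : ∀ a u, a ≠ j → I a = some u → ¬ G.Adj w u := by
        intro a u _ hau hadj
        have hbu : blk u = a := hblk a u (mem a u hau)
        exact ne_some_of_lastConflict_eq_none hi ((hL w u).2 hadj) (by rw [hbu, hau])
      refine ⟨?_, by simp [h19'], by simpa using hst.2, fun i' => ?_, fun i' => ?_,
        fun i' w' hI' => ?_, ?_⟩
      · repeat' first | exact hs' | refine Same.setReg ?_ | refine Same.setArr ?_
      · simp only [Memory.arr_setArr]
        norm_num [h9', h8']
        by_cases hii : i' = j
        · subst hii; simp
        · rw [update_of_ne (fun e => hii (Fin.ext e)), update_of_ne hii]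
          exact hch i'
      · by_cases hii : i' = j
        · subst hii; simp
        · rw [update_of_ne hii]
          rcases full i' with h | h
          · exact .inl ((List.mem_cons.1 h).resolve_left hii)
          · exact .inr h
      · by_cases hii : i' = j
        · subst hii
          rw [update_self] at hI'
          rwa [← Option.some.inj hI']
        · rw [update_of_ne hii] at hI'
          exact mem _ _ hI'
      · intro a b ua ub ha hb
        by_cases haj : a = j
        · subst haj
          rw [update_self] at ha
          obtain rfl := Option.some.inj ha
          by_cases hbj : b = a
          · subst hbj
            rw [update_self] at hb
            obtain rfl := Option.some.inj hb
            exact G.irrefl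
          · rw [update_of_ne hbj] at hb
            exact hno b ub hbj hb
        · rw [update_of_ne haj] at ha
          by_cases hbj : b = j
          · subst hbj
            rw [update_self] at hb
            obtain rfl := Option.some.inj hb
            exact fun h => hno a ua haj ha h.symm
          · rw [update_of_ne hbj] at hb
            exact indep a b ua ub ha hb
  · have := hd w
    omega

/-- The cost of one round of the walk. -/
theorem walk_round_cost (hm : HoldsInput L blk m₀) (hL : ∀ v u, u ∈ L v ↔ G.Adj v u) {d : ℕ}
    (hd : ∀ v, (L v).length ≤ d) (hcl : HoldsCands cl m₀) (hblk : ∀ i, ∀ w ∈ cl i, blk w = i)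
    {D : ℕ} (hD : ∀ i, (cl i).length ≤ D) (hpos : ∀ i, 0 < (cl i).length)
    {j : Fin k} {σ : List (Fin k)} {I : Fin k → Option (Fin n)}
    (hst : IsWalkState G cl m₀ (j :: σ) I m) (g : Memory → ℝ≥0∞) (K : List Prog) (T : ℕ)
    (B : ℕ → ℝ≥0∞)
    (hB : ∀ (r : ℕ) (hr : r < (cl j).length) (m' : Memory),
      IsNextState G cl L blk m₀ j σ I (cl j)[r] m' → cost g T ⟨K, m'⟩ ≤ B r) :
    cost g T ⟨.seq draw₁ (.seq (.rand 20 17) (.seq draw₂ tryVertex)) :: K, m⟩ ≤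
      ((d * 13 + D * 4 + 50 : ℕ) : ℝ≥0∞) +
        ((cl j).length : ℝ≥0∞)⁻¹ * ∑ r ∈ Finset.range (cl j).length, B r := by
  set ℓ := (cl j).length with hℓ
  have hdraw : Ht m draw₁ 5 fun m' => m' = (((m.setReg 19 σ.length).setReg 9 j).setReg 17 ℓ) := by
    have h19 : m.reg 19 - 1 = σ.length := by rw [hst.height]; rfl
    have h9 : m.arr 10 σ.length = j := hst.stack.1
    have h6 : m.arr 6 j = ℓ := by rw [hst.same.arr 6]; exact (hcl j).1
    refine Ht.decr_seq <| Ht.load_seq <| Ht.load ?_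
    rw [h19]
    simp only [Memory.reg_setReg, Memory.arr_setReg, if_true, h9, h6]
  set m₁ := ((m.setReg 19 σ.length).setReg 9 j).setReg 17 ℓ with hm₁
  have hs₁ : Same [8, 9, 12, 13, 14, 15, 17, 19, 20, 21, 22, 23] [9, 10] m₀ m₁ := by
    repeat' first | exact hst.same | refine Same.setReg ?_
  set τ₁ := d * 13 + D * 4 + 35 with hτ₁
  have hfin : ∀ r, (hr : r < ℓ) → cost g T ⟨.seq draw₂ tryVertex :: K, m₁.setReg 20 r⟩ ≤
      τ₁ + B r := by
    intro r hr
    have hw : (cl j)[r] ∈ cl j := List.getElem_mem hr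
    have h7 : m.arr 7 = m₀.arr 7 := hst.same.arr 7
    have h8 : m.arr 8 = m₀.arr 8 := hst.same.arr 8
    have hd2 : Ht (m₁.setReg 20 r) draw₂ (r * 4 + 5) fun m' =>
        Same [8, 21] [] (m₁.setReg 20 r) m' ∧ m'.reg 8 = ((cl j)[r] : Fin n) := by
      refine (Ht.load_seq <| Ht.forLoop (N := r) (τ := 1) (fun i m' =>
        Same [8, 21] [] (m₁.setReg 20 r) m' ∧ m'.reg 21 = i ∧
          m'.reg 8 = (m₀.arr 8)^[i] (m₀.arr 7 j)) ?_ ?_ ?_ ?_).weaken ?_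
      · rintro i m' ⟨hs, h, -⟩
        exact ⟨h, by rw [hs.reg 20]; simp⟩
      · refine ⟨(Same.refl _ _ _).setReg.setReg, by simp, ?_⟩
        simp [hm₁, h7]
      · rintro i m' hi ⟨hs, h21, h8'⟩
        refine Ht.load ⟨hs.setReg.setReg, by simp [h21], ?_⟩
        have : m'.arr 8 = m₀.arr 8 := by rw [hs.arr 8, ← h8]; rfl
        rw [Function.iterate_succ_apply']
        simp [this, h8']
      · rintro m' ⟨hs, -, h⟩
        refine ⟨hs, ?_⟩
        rw [h, (hcl j).2.iterate hr]
      · omega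
    have htot : Ht (m₁.setReg 20 r) (.seq draw₂ tryVertex) τ₁
        (IsNextState G cl L blk m₀ j σ I (cl j)[r]) := by
      refine (Ht.seq hd2 fun m' hm' => ?_).weaken
        (show 1 + (r * 4 + 5) + (d * 13 + 25) ≤ τ₁ by have := hD j; omega)
      obtain ⟨hs, h8'⟩ := hm'
      have harr : m'.arr 10 = m.arr 10 := hs.arr 10
      have harr9 : m'.arr 9 = m.arr 9 := hs.arr 9
      refine tryVertex_spec hm hL hd hblk hw ((hs₁.setReg (x := 20) (v := r)).trans hs) h8' ?_ ?_ ?_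
        ?_ hst.full hst.mem hst.indep
      · rw [hs.reg 9]; simp [hm₁]
      · rw [hs.reg 19]; simp [hm₁]
      · rw [harr]; exact hst.stack
      · rw [harr9]; exact hst.chosen
    exact htot g K (B r) T fun m' hm' => hB r hr m' hm'
  -- A rule of type `Ht` would keep only the worst outcome of the draw. The average is needed here,
  -- so the cost is expanded directly.
  have hrand : cost g T ⟨.rand 20 17 :: .seq draw₂ tryVertex :: K, m₁⟩ ≤
      1 + (τ₁ + (ℓ : ℝ≥0∞)⁻¹ * ∑ r ∈ Finset.range ℓ, B r) := by
    refine cost_cons_le.trans ?_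
    gcongr
    have h17 : m₁.reg 17 = ℓ := by simp [hm₁]
    rw [step, expect_map, h17, expect_uniformBelow ℓ (hpos j)]
    have hℓ0 : (ℓ : ℝ≥0∞) ≠ 0 := by exact_mod_cast (hpos j).ne'
    calc _ ≤ (ℓ : ℝ≥0∞)⁻¹ * ∑ r ∈ Finset.range ℓ, ((τ₁ : ℝ≥0∞) + B r) := by
          gcongr with r hr
          exact hfin r (Finset.mem_range.1 hr)
      _ = _ := by
          rw [Finset.sum_add_distrib, mul_add, Finset.sum_const, Finset.card_range, nsmul_eq_mul,
            ← mul_assoc, ENNReal.inv_mul_cancel hℓ0 (ENNReal.natCast_ne_top _), one_mul]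
  have hseq : cost g T ⟨.seq (.rand 20 17) (.seq draw₂ tryVertex) :: K, m₁⟩ ≤
      1 + (1 + (τ₁ + (ℓ : ℝ≥0∞)⁻¹ * ∑ r ∈ Finset.range ℓ, B r)) :=
    (cost_le_of_step (c := ⟨.rand 20 17 :: .seq draw₂ tryVertex :: K, m₁⟩) rfl).trans
      (by gcongr)
  refine (cost_le_of_step (c := ⟨draw₁ :: .seq (.rand 20 17) (.seq draw₂ tryVertex) :: K, m⟩)
    rfl).trans ?_
  calc _ ≤ 1 + (((5 : ℕ) : ℝ≥0∞) + (1 + (1 + (τ₁ + (ℓ : ℝ≥0∞)⁻¹ * ∑ r ∈ Finset.range ℓ, B r)))) := by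
        gcongr
        exact hdraw g _ _ T (by rintro _ rfl; exact hseq)
    _ = ((1 + 5 + 1 + 1 + τ₁ : ℕ) : ℝ≥0∞) + (ℓ : ℝ≥0∞)⁻¹ * ∑ r ∈ Finset.range ℓ, B r := by
        push_cast; ring
    _ ≤ _ := add_le_add (Nat.cast_le.2 (by omega)) le_rfl

theorem sum_range_length {α : Type*} (l : List α) (f : α → ℝ≥0) :
    ∑ r ∈ Finset.range l.length, (if h : r < l.length then f l[r] else 0) = (l.map f).sum := by
  rw [Finset.sum_range, ← Fin.sum_univ_fun_getElem]
  exact Finset.sum_congr rfl fun i _ => dif_pos i.2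

theorem sum_map_finset_sum {α ι : Type*} (l : List α) (s : Finset ι) (f : ι → α → ℝ≥0) :
    (l.map fun w => ∑ t ∈ s, f t w).sum = ∑ t ∈ s, (l.map (f t)).sum := by
  induction l with
  | nil => simp
  | cons a l ih => simp [ih, Finset.sum_add_distrib]

open TransversalWalk in
/-- The cost of the walk in terms of its expected number of rounds. -/
theorem walk_cost (hm : HoldsInput L blk m₀) (hL : ∀ v u, u ∈ L v ↔ G.Adj v u) {d : ℕ}
    (hd : ∀ v, (L v).length ≤ d) (hcl : HoldsCands cl m₀) (hblk : ∀ i, ∀ w ∈ cl i, blk w = i)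
    {D : ℕ} (hD : ∀ i, (cl i).length ≤ D) (hpos : ∀ i, 0 < (cl i).length)
    (g : Memory → ℝ≥0∞) (K : List Prog) (B : ℝ≥0∞) (T : ℕ)
    (hB : ∀ I m', IsWalkState G cl m₀ [] I m' → cost g T ⟨K, m'⟩ ≤ B)
    {σ : List (Fin k)} {I : Fin k → Option (Fin n)} (hst : IsWalkState G cl m₀ σ I m) :
    cost g T ⟨walk :: K, m⟩ ≤ ((d * 13 + D * 4 + 51 : ℕ) : ℝ≥0∞) *
      ((∑ t ∈ Finset.range T, surv cl (fun I w => lastConflict blk I (L w)) t σ I : ℝ≥0) : ℝ≥0∞) +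
      (1 + B) := by
  set pick : (Fin k → Option (Fin n)) → Fin n → Option (Fin k) :=
    fun I w => lastConflict blk I (L w) with hpick
  set τ := d * 13 + D * 4 + 51 with hτ
  induction T generalizing m σ I with
  | zero => simp [cost]
  | succ T ih =>
    have h3 : m.reg 3 = 0 := (hm.of_same hst.same).reg_zero
    cases σ with
    | nil =>
      refine le_add_of_nonneg_of_le zero_le ?_
      refine (cost_le_of_step (c := ⟨K, m⟩) ?_).trans ?_
      · change PMF.pure (if m.reg 3 < m.reg 19 then _ else _) = _
        rw [if_neg (by rw [h3, hst.height]; simp)]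
      · gcongr
        exact hB _ _ hst
    | cons j σ =>
      set ℓ := (cl j).length with hℓ
      have hℓ0 : (ℓ : ℝ≥0∞) ≠ 0 := by exact_mod_cast (hpos j).ne'
      have hguard : m.reg 3 < m.reg 19 := by rw [h3, hst.height]; simp
      set F : Fin n → ℝ≥0 := fun w => ∑ t ∈ Finset.range T, (match pick I w with
        | none => surv cl pick t σ (update I j (some w))
        | some i => surv cl pick t (i :: j :: σ) (update I i none)) with hF
      set F' : ℕ → ℝ≥0 := fun r => if h : r < (cl j).length then F (cl j)[r] else 0 with hF'
      have hround := walk_round_cost hm hL hd hcl hblk hD hpos hst g (walk :: K) T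
        (fun r => (τ : ℝ≥0∞) * ((F' r : ℝ≥0) : ℝ≥0∞) + (1 + B)) (by
          intro r hr m' hm'
          -- The induction hypothesis has the horizon `T`; the assumption for `T + 1` passes down by
          -- monotonicity.
          have hB' : ∀ I m', IsWalkState G cl m₀ [] I m' → cost g T ⟨K, m'⟩ ≤ B :=
            fun I m' h => (cost_mono_succ g T _).trans (hB I m' h)
          simp only [hF', dif_pos hr, hF]
          unfold IsNextState at hm'
          change (match pick I (cl j)[r] with
            | none => IsWalkState G cl m₀ σ (update I j (some (cl j)[r])) m'
            | some i => IsWalkState G cl m₀ (i :: j :: σ) (update I i none) m') at hm'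
          cases hp : pick I (cl j)[r] with
          | none =>
            rw [hp] at hm'
            exact ih hB' hm'
          | some i =>
            rw [hp] at hm'
            exact ih hB' hm')
      -- The summand 1 is the survival at time 0. It pays for the current round, including the test
      -- of the loop, whence 51 instead of 50.
      have hsum : ∑ t ∈ Finset.range (T + 1), surv cl pick t (j :: σ) I =
          (ℓ : ℝ≥0)⁻¹ * ∑ r ∈ Finset.range ℓ, F' r + 1 := by
        rw [Finset.sum_range_succ']
        congr 1
        simp only [surv]
        rw [← Finset.mul_sum, hF', sum_range_length, hF]
        congr 1
        rw [← sum_map_finset_sum]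
        refine congrArg List.sum (List.map_congr_left fun w _ => Finset.sum_congr rfl fun t _ => ?_)
        cases pick I w <;> rfl
      rw [hsum]
      have hcost : cost g (T + 1) ⟨walk :: K, m⟩ = 1 + cost g T
          ⟨.seq draw₁ (.seq (.rand 20 17) (.seq draw₂ tryVertex)) :: walk :: K, m⟩ := by
        rw [cost]
        congr 1
        simp only [walk, step, if_pos hguard, expect_pure]
      rw [hcost]
      refine (add_le_add_right hround 1).trans_eq ?_
      rw [Finset.sum_add_distrib, Finset.sum_const, Finset.card_range, nsmul_eq_mul, mul_add,
        ← mul_assoc (_⁻¹) (_ : ℝ≥0∞) (1 + B), ENNReal.inv_mul_cancel hℓ0 (ENNReal.natCast_ne_top _),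
        one_mul, ← Finset.mul_sum]
      have hℓ1 : (ℓ : ℝ≥0) ≠ 0 := by exact_mod_cast (hpos j).ne'
      rw [ENNReal.coe_add, ENNReal.coe_mul, ENNReal.coe_inv hℓ1, ENNReal.coe_natCast,
        ENNReal.ofNNReal_finsetSum, hτ]
      push_cast
      ring

end Walk

end RAM

/-! ### One phase: recolouring along an independent transversal -/

namespace RAM

open Function

open scoped ENNReal NNReal

/-- A colouring that is bijective on each block and proper on the vertices below `t`. -/
structure IsPartialStrong {n k : ℕ} (G : SimpleGraph (Fin n)) (blk : Fin n → Fin k) (b t : ℕ)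
    (col : Fin n → ℕ) : Prop where
  lt : ∀ v, col v < b
  inj : ∀ u v, blk u = blk v → col u = col v → u = v
  surj : ∀ i, ∀ c < b, ∃ v, blk v = i ∧ col v = c
  proper : ∀ u v : Fin n, (u : ℕ) < t → (v : ℕ) < t → G.Adj u v → col u ≠ col v

section Coloring

variable {n k : ℕ} {G : SimpleGraph (Fin n)} {blk : Fin n → Fin k} {b : ℕ}

/-- The colouring after exchanging the colours of `x i` and `y i` in each block `i`. -/
def exchange (blk : Fin n → Fin k) (x y : Fin k → Fin n) (col : Fin n → ℕ) (v : Fin n) : ℕ :=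
  col (Equiv.swap (x (blk v)) (y (blk v)) v)

/-- A vertex `y i` now has colour `col t`, and the vertices of that colour are exactly the `y i`,
which are independent. A displaced `x i` has a colour that none of its neighbours had before. A
neighbour that is itself a displaced `x j` is impossible below `t`, since both had the colour of
`t`. All other pairs keep their colours. -/
theorem IsPartialStrong.exchange {t : Fin n} {col : Fin n → ℕ}
    (h : IsPartialStrong G blk b t col) {x y : Fin k → Fin n} (hx : ∀ i, blk (x i) = i)
    (hxc : ∀ i, col (x i) = col t) (hy : ∀ i, blk (y i) = i) (hyt : y (blk t) = t)
    (hxy : ∀ i, i ≠ blk t → ∀ u, G.Adj (x i) u → col u ≠ col (y i))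
    (hind : ∀ i j, ¬ G.Adj (y i) (y j)) :
    IsPartialStrong G blk b (t + 1) (exchange blk x y col) := by
  have hxt : x (blk t) = t := h.inj _ _ (hx _) (hxc _)
  have hblk : ∀ v, blk (Equiv.swap (x (blk v)) (y (blk v)) v) = blk v := by
    intro v
    rw [Equiv.swap_apply_def]
    split_ifs
    · exact hy _
    · exact hx _
    · rfl
  have hy_col : ∀ i, RAM.exchange blk x y col (y i) = col t := by
    intro i
    rw [RAM.exchange, hy, Equiv.swap_apply_right, hxc]
  have hx_col : ∀ i, RAM.exchange blk x y col (x i) = col (y i) := by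
    intro i
    rw [RAM.exchange, hx, Equiv.swap_apply_left]
  have hinj : ∀ u v, blk u = blk v → RAM.exchange blk x y col u = RAM.exchange blk x y col v →
      u = v := by
    intro u v hb hc
    have := h.inj _ _ ((hblk u).trans (hb.trans (hblk v).symm)) hc
    rw [hb] at this
    exact (Equiv.swap _ _).injective this
  refine ⟨fun v => h.lt _, hinj, ?_, ?_⟩
  · intro i c hc
    obtain ⟨v, hv, hvc⟩ := h.surj i c hc
    have hb : blk (Equiv.swap (x i) (y i) v) = i := by rw [← hv, hblk]
    refine ⟨Equiv.swap (x i) (y i) v, hb, ?_⟩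
    rw [RAM.exchange, hb, Equiv.swap_apply_self, hvc]
  · have hmove : ∀ u w : Fin n, G.Adj u w → u = y (blk u) →
        RAM.exchange blk x y col u ≠ RAM.exchange blk x y col w := by
      intro u w hadj hu heq
      rw [hu, hy_col, ← hy_col (blk w)] at heq
      have hw := hinj _ _ (hy _) heq
      rw [hu, ← hw] at hadj
      exact hind _ _ hadj
    -- The new vertex `t` is one of the `y i`, so every other kind of vertex lies in the range where
    -- the old colouring is proper.
    have hlt : ∀ u : Fin n, (u : ℕ) < t + 1 → u ≠ y (blk u) → (u : ℕ) < t := by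
      intro u hu hne
      have : u ≠ t := by rintro rfl; exact hne hyt.symm
      have : (u : ℕ) ≠ t := fun e => this (Fin.ext e)
      omega
    have hstay : ∀ u : Fin n, u ≠ y (blk u) → u ≠ x (blk u) →
        RAM.exchange blk x y col u = col u := by
      intro u h1 h2
      rw [RAM.exchange, Equiv.swap_apply_of_ne_of_ne h2 h1]
    have hxcase : ∀ u w : Fin n, G.Adj u w → u ≠ y (blk u) → u = x (blk u) → w ≠ y (blk w) →
        w ≠ x (blk w) → RAM.exchange blk x y col u ≠ RAM.exchange blk x y col w := by
      intro u w hadj h1 h2 h3 h4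
      rw [hstay w h3 h4]
      conv_lhs => rw [h2, hx_col]
      refine (hxy (blk u) ?_ w (h2 ▸ hadj)).symm
      intro hbt
      rw [hbt, hyt] at h1
      rw [hbt, hxt] at h2
      exact h1 h2
    intro u w hu hw hadj
    by_cases hu1 : u = y (blk u)
    · exact hmove u w hadj hu1
    by_cases hw1 : w = y (blk w)
    · exact (hmove w u hadj.symm hw1).symm
    by_cases hu2 : u = x (blk u)
    · by_cases hw2 : w = x (blk w)
      · refine absurd ?_ (h.proper u w (hlt u hu hu1) (hlt w hw hw1) hadj)
        rw [hu2, hw2, hxc, hxc]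
      · exact hxcase u w hadj hu1 hu2 hw1 hw2
    · by_cases hw2 : w = x (blk w)
      · exact (hxcase w u hadj.symm hw1 hw2 hu1 hu2).symm
      · rw [hstay u hu1 hu2, hstay w hw1 hw2]
        exact h.proper u w (hlt u hu hu1) (hlt w hw hw1) hadj

/-- A list that is too short contains all admissible vertices of the block. The inadmissible ones
have distinct colours, all occurring on the at most `d` neighbours of `x i`, so the block would have
fewer than `4 * d + d ≤ b` vertices. -/
theorem IsCandList.length_eq {col : Fin n → ℕ} (hinj : ∀ u v, blk u = blk v → col u = col v → u = v)
    {L : Fin n → List (Fin n)} {d : ℕ} (hd : ∀ v, (L v).length ≤ d) (hb : 5 * d ≤ b)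
    {x : Fin k → Fin n} {i : Fin k} (hcard : (Finset.univ.filter fun v => blk v = i).card = b)
    {l : List (Fin n)}
    (h : IsCandList blk (fun w => ∀ u ∈ L (x (blk w)), col u ≠ col w) (4 * d) n i l) :
    l.length = 4 * d := by
  refine le_antisymm h.length_le (not_lt.1 fun hlt => ?_)
  have hall := h.complete hlt
  have h1 : (Finset.univ.filter fun v => blk v = i) ⊆ l.toFinset ∪
      (Finset.univ.filter fun v => blk v = i ∧ ∃ u ∈ L (x i), col u = col v) := by
    intro w hw
    simp only [Finset.mem_filter, Finset.mem_univ, true_and] at hw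
    by_cases hP : ∀ u ∈ L (x (blk w)), col u ≠ col w
    · exact Finset.mem_union_left _ (List.mem_toFinset.2 (hall w w.2 hw hP))
    · refine Finset.mem_union_right _ (Finset.mem_filter.2 ⟨Finset.mem_univ _, hw, ?_⟩)
      rw [hw] at hP
      push Not at hP
      exact hP
  have h2 : (Finset.univ.filter fun v => blk v = i ∧ ∃ u ∈ L (x i), col u = col v).card ≤ d := by
    rw [← Finset.card_image_of_injOn (f := col)]
    · refine (Finset.card_le_card (t := ((L (x i)).map col).toFinset) ?_).trans
        ((List.toFinset_card_le _).trans ((List.length_map _).trans_le (hd _)))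
      intro c hc
      simp only [Finset.mem_image, Finset.mem_filter, Finset.mem_univ, true_and] at hc
      obtain ⟨v, ⟨-, u, hu, huv⟩, rfl⟩ := hc
      exact List.mem_toFinset.2 (List.mem_map.2 ⟨u, hu, huv⟩)
    · intro u hu v hv huv
      simp only [Finset.coe_filter, Finset.mem_univ, true_and, Set.mem_ofPred_eq] at hu hv
      exact hinj u v (hu.1.trans hv.1.symm) huv
  have h3 := (Finset.card_le_card h1).trans (Finset.card_union_le _ _)
  have h4 := List.toFinset_card_le l
  omega

end Coloring

section Phase

variable {n k : ℕ} {G : SimpleGraph (Fin n)} {L : Fin n → List (Fin n)} {blk : Fin n → Fin k}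
  {m : Memory} {b : ℕ}

theorem swapColors_spec (hm : HoldsInput L blk m) {col : Fin n → ℕ}
    (hcol : ∀ v : Fin n, m.arr 3 v = col v) {x y : Fin k → Fin n} (hx : ∀ i, blk (x i) = i)
    (hy : ∀ i, blk (y i) = i) (hxm : ∀ i : Fin k, m.arr 5 i = x i)
    (hym : ∀ i : Fin k, m.arr 9 i = y i) (hxc : ∀ i, col (x i) = m.reg 6) :
    Ht m swapColors (k * 12 + 3) fun m' => Same [8, 9, 10, 11] [3] m m' ∧
      ∀ v : Fin n, m'.arr 3 v = exchange blk x y col v := by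
  refine (Ht.forLoop (N := k) (τ := 9) (fun j m' => Same [8, 9, 10, 11] [3] m m' ∧ m'.reg 9 = j ∧
    ∀ v : Fin n, m'.arr 3 v = if (blk v : ℕ) < j then exchange blk x y col v else col v)
    ?_ ?_ ?_ ?_).weaken ?_
  · rintro j m' ⟨hs, h, -⟩
    exact ⟨h, (hs.reg 1).trans hm.reg_k⟩
  · refine ⟨(Same.refl _ _ _).setReg, by simp, by simp [hcol]⟩
  · rintro j m' hj ⟨hs, h9, hc⟩
    set i : Fin k := ⟨j, hj⟩ with hi
    have h5 : m'.arr 5 j = x i := by rw [hs.arr 5]; exact hxm i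
    have h9' : m'.arr 9 j = y i := by rw [hs.arr 9]; exact hym i
    have h6 : m'.reg 6 = m.reg 6 := hs.reg 6
    -- The blocks are disjoint, so the exchanges already made do not affect block `i`.
    have hcy : m'.arr 3 (y i) = col (y i) := by
      rw [hc, if_neg]
      rw [hy]
      simp [hi]
    refine (Ht.load_seq <| Ht.load_seq <| Ht.load_seq <| Ht.store_seq <| Ht.store ⟨?_, ?_, ?_⟩).weaken
      (by omega)
    · repeat' first | exact hs | refine Same.setReg ?_ | refine Same.setArr ?_
    · simp [h9]
    · intro v
      simp only [Memory.reg_setReg, Memory.arr_setReg, Memory.reg_setArr, Memory.arr_setArr]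
      norm_num [h9, h5, h9', h6, hcy]
      by_cases hv : blk v = i
      · rw [if_pos (by rw [hv]), RAM.exchange, hv]
        by_cases hvy : v = y i
        · rw [hvy, update_self, Equiv.swap_apply_right, hxc]
        · rw [update_of_ne (fun e => hvy (Fin.ext e))]
          by_cases hvx : v = x i
          · rw [hvx, update_self, Equiv.swap_apply_left]
          · rw [update_of_ne (fun e => hvx (Fin.ext e)), Equiv.swap_apply_of_ne_of_ne hvx hvy, hc,
              if_neg]
            rw [hv]
            simp [hi]
      · have hne : (blk v : ℕ) ≠ j := fun e => hv (Fin.ext e)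
        rw [update_of_ne (fun e => hv (by rw [show v = y i from Fin.ext e, hy])),
          update_of_ne (fun e => hv (by rw [show v = x i from Fin.ext e, hx])), hc]
        by_cases hlt : (blk v : ℕ) < j
        · rw [if_pos hlt, if_pos hlt.le]
        · rw [if_neg hlt, if_neg (by omega)]
  · rintro m' ⟨hs, -, h⟩
    refine ⟨hs, fun v => ?_⟩
    rw [h, if_pos (blk v).2]
  · omega

/-- The bound is the product of `80 * d` steps per round, for reading a list of candidates and an
adjacency list, and `16 * d ^ 2 * k` expected rounds, plus one step for leaving the loop. -/
theorem walk_spec (hm : HoldsInput L blk m) (hL : ∀ v u, u ∈ L v ↔ G.Adj v u)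
    {d : ℕ} (hd : ∀ v, (L v).length ≤ d) (hd1 : 1 ≤ d) {cl : Fin k → List (Fin n)}
    (hcl : HoldsCands cl m) (hblk : ∀ i, ∀ w ∈ cl i, blk w = i) (hnd : ∀ i, (cl i).Nodup)
    {z : Fin k} (hz : (cl z).length = 1) (hlen : ∀ i, i ≠ z → (cl i).length = 4 * d)
    (h9 : ∀ i : Fin k, m.arr 9 i = n) {σ : List (Fin k)} (hσ : (σ ++ [z]).Nodup)
    (hall : ∀ i, i ∈ σ ++ [z]) (h19 : m.reg 19 = (σ ++ [z]).length)
    (hst : IsStack (m.arr 10) (σ ++ [z])) :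
    Ht m walk (80 * d * (16 * d ^ 2 * k) + 1) fun m' => ∃ I, IsWalkState G cl m [] I m' := by
  classical
  intro g K B T hB
  have hpos : ∀ i, 0 < (cl i).length := by
    intro i
    by_cases hi : i = z
    · rw [hi, hz]; exact one_pos
    · rw [hlen i hi]; omega
  have hD : ∀ i, (cl i).length ≤ 4 * d := by
    intro i
    by_cases hi : i = z
    · rw [hi, hz]; omega
    · rw [hlen i hi]
  have hdeg : ∀ w, ∀ s : Finset (Fin n), (∀ u ∈ s, G.Adj w u) → s.card ≤ d := by
    intro w s hs
    refine (Finset.card_le_card (t := (L w).toFinset) fun u hu => ?_).trans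
      ((List.toFinset_card_le _).trans (hd w))
    exact List.mem_toFinset.2 ((hL w u).2 (hs u hu))
  have hstate : IsWalkState G cl m (σ ++ [z]) (fun _ => none) m :=
    ⟨Same.refl _ _ _, h19, hst, by simpa using h9, fun i => .inl (hall i), by simp, by simp⟩
  refine (walk_cost hm hL hd hcl hblk hD hpos g K B T (fun I m' h => hB m' ⟨I, h⟩) hstate).trans ?_
  have hsum := TransversalWalk.sum_surv_le hblk hnd hd1 hz hlen (Adj := G.Adj)
    (fun u w h => h.symm) hdeg (pick := fun I w => lastConflict blk I (L w)) (by
      intro I w i h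
      obtain ⟨u, hu, hI⟩ := exists_of_lastConflict_eq_some h
      exact ⟨u, hI, (hL w u).1 hu⟩) hσ hall T
  rw [Fintype.card_fin] at hsum
  have hsum' : ((∑ t ∈ Finset.range T, TransversalWalk.surv cl (fun I w => lastConflict blk I (L w)) t
      (σ ++ [z]) (fun _ => none) : ℝ≥0) : ℝ≥0∞) ≤ ((16 * d ^ 2 * k : ℕ) : ℝ≥0∞) := by
    rw [← ENNReal.coe_natCast]
    refine ENNReal.coe_le_coe.2 (hsum.trans_eq ?_)
    push_cast
    ring
  -- The additive constant is absorbed by `51 * d`, as `1 ≤ d`.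
  have hτ : ((d * 13 + 4 * d * 4 + 51 : ℕ) : ℝ≥0∞) ≤ ((80 * d : ℕ) : ℝ≥0∞) :=
    Nat.cast_le.2 (by omega)
  refine (add_le_add (mul_le_mul' hτ hsum') le_rfl).trans_eq ?_
  push_cast
  ring

theorem phase_spec (hm : HoldsInput L blk m) (hL : ∀ v u, u ∈ L v ↔ G.Adj v u)
    {d : ℕ} (hd : ∀ v, (L v).length ≤ d) (hd1 : 1 ≤ d) (hb : 5 * d ≤ b)
    (hcard : ∀ i, (Finset.univ.filter fun v => blk v = i).card = b) (hkn : 5 * d * k ≤ n)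
    {t : Fin n} (h5 : m.reg 5 = t) (h4 : m.reg 4 = 4 * d) {col : Fin n → ℕ}
    (hcol : ∀ v : Fin n, m.arr 3 v = col v) (h : IsPartialStrong G blk b t col) :
    Ht m phase (n * d ^ 2 * 500) fun m' =>
      Same [6, 7, 8, 9, 10, 11, 12, 13, 14, 15, 16, 17, 18, 19, 20, 21, 22, 23]
        [3, 5, 6, 7, 8, 9, 10] m m' ∧
      ∃ col' : Fin n → ℕ, (∀ v : Fin n, m'.arr 3 v = col' v) ∧
        IsPartialStrong G blk b (t + 1) col' := by
  choose x hx hxc using fun i => h.surj i (col t) (h.lt t)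
  set z := blk t with hz
  have hn1 : 1 ≤ n := Nat.one_le_of_lt t.2
  have h3 : m.arr 3 t = col t := hcol t
  have h2 : m.arr 2 t = z := hm.arr_blk t
  set m₁ := (m.setReg 6 (col t)).setReg 7 z with hm₁
  have hs₁ : Same [6, 7] [] m m₁ := by
    repeat' first | exact Same.refl _ _ _ | refine Same.setReg ?_
  suffices H : Ht m₁ (.seq findColored <| .seq clearBlocks <| .seq findCandidates <|
      .seq setSpecial <| .seq makeStack <| .seq walk swapColors) (1 + (n * 11 + 3) + (1 + (k * 6 + 3) +
        (1 + (n * (d * 20 + 50) + 3) + (1 + 5 + (1 + (k * 20 + 20) +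
          (1 + (80 * d * (16 * d ^ 2 * k) + 1) + (k * 12 + 3))))))) fun m' =>
      Same [6, 7, 8, 9, 10, 11, 12, 13, 14, 15, 16, 17, 18, 19, 20, 21, 22, 23]
        [3, 5, 6, 7, 8, 9, 10] m₁ m' ∧
      ∃ col' : Fin n → ℕ, (∀ v : Fin n, m'.arr 3 v = col' v) ∧
        IsPartialStrong G blk b (t + 1) col' by
    have hH := H.mono le_rfl (R := fun m' =>
      Same [6, 7, 8, 9, 10, 11, 12, 13, 14, 15, 16, 17, 18, 19, 20, 21, 22, 23]
        [3, 5, 6, 7, 8, 9, 10] m m' ∧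
      ∃ col' : Fin n → ℕ, (∀ v : Fin n, m'.arr 3 v = col' v) ∧
        IsPartialStrong G blk b (t + 1) col') fun m' hm' => ⟨hs₁.mono.trans hm'.1, hm'.2⟩
    have e : (m.setReg 6 (m.arr 3 (m.reg 5))).setReg 7 ((m.setReg 6 (m.arr 3 (m.reg 5))).arr 2
        ((m.setReg 6 (m.arr 3 (m.reg 5))).reg 5)) = m₁ := by
      rw [h5, h3]
      simp [h5, h2, hm₁]
    rw [← e] at hH
    refine (Ht.load_seq (Ht.load_seq hH)).weaken ?_
    -- Here the size of the blocks saves a factor: `5 * d * k ≤ n` turns the cubic power of `d` into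
    -- a quadratic one.
    have hdk : 80 * d * (16 * d ^ 2 * k) ≤ 256 * (d ^ 2 * n) := by
      calc 80 * d * (16 * d ^ 2 * k) = 256 * (d ^ 2 * (5 * d * k)) := by ring
        _ ≤ _ := by gcongr
    have hk : k ≤ n := by nlinarith
    have hdd : d ≤ d ^ 2 := by nlinarith
    have h1 : n * 1 ≤ n * d ^ 2 := Nat.mul_le_mul_left n (by nlinarith)
    have h2 : n * d ≤ n * d ^ 2 := Nat.mul_le_mul_left n hdd
    have h3 : n * (d * 20 + 50) = 20 * (n * d) + 50 * n := by ring
    have h4 : d ^ 2 * n = n * d ^ 2 := by ring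
    omega
  have hin₁ := hm.of_same hs₁
  have hcol₁ : ∀ v : Fin n, m₁.arr 3 v = col v := hcol
  refine Ht.seq (findColored_spec hin₁ hcol₁ h.inj) ?_
  rintro m₂ ⟨hs₂, hx₂⟩
  have hx₂' : ∀ i : Fin k, m₂.arr 5 i = x i := by
    intro i
    have := hx₂ (x i) (by rw [hxc]; simp [hm₁])
    rwa [hx] at this
  refine Ht.seq (clearBlocks_spec (hin₁.of_same hs₂)) ?_
  rintro m₃ ⟨hs₃, h₃⟩
  have hs13 : Same [8, 9, 11] [5, 6, 9] m₁ m₃ := hs₂.mono.trans hs₃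
  have hin₃ := hin₁.of_same hs13
  refine Ht.seq (findCandidates_spec hin₃ hd (col := col) (x := x)
    (by rw [hs13.arr 3]; exact hcol₁) (by rw [hs₃.arr 5]; exact hx₂') (fun i => (h₃ i).1)) ?_
  rintro m₄ ⟨hs₄, cl, hcl, hcand⟩
  have hs14 : Same [8, 9, 10, 11, 12, 13, 14, 15, 16, 17, 18] [5, 6, 7, 8, 9] m₁ m₄ :=
    hs13.mono.trans hs₄
  have h34 : m₃.reg 4 = 4 * d := by
    rw [hs13.reg 4, hs₁.reg 4, h4]
  rw [h34] at hcand
  refine Ht.seq (setSpecial_spec hcl (t := t) (z := z) (by rw [hs14.reg 5, hs₁.reg 5, h5])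
    (by rw [hs14.reg 7]; simp [hm₁])) ?_
  rintro m₅ ⟨hs₅, hcl₅⟩
  have hs15 : Same [8, 9, 10, 11, 12, 13, 14, 15, 16, 17, 18] [5, 6, 7, 8, 9] m₁ m₅ :=
    hs14.trans hs₅
  have hin₅ := hin₁.of_same hs15
  refine Ht.seq (makeStack_spec hin₅ (z := z) (by rw [hs15.reg 7]; simp [hm₁])) ?_
  rintro m₆ ⟨hs₆, σ, hσ, hall, h19, hst⟩
  have hs16 : Same [8, 9, 10, 11, 12, 13, 14, 15, 16, 17, 18, 19] [5, 6, 7, 8, 9, 10] m₁ m₆ :=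
    hs15.mono.trans hs₆
  have hin₆ := hin₁.of_same hs16
  set cl' := update cl z [t] with hcl'
  have hcl₆ : HoldsCands cl' m₆ := by
    intro i
    rw [hs₆.arr 6, hs₆.arr 7, hs₆.arr 8]
    exact hcl₅ i
  have hlz : cl' z = [t] := update_self ..
  have hlne : ∀ i, i ≠ z → cl' i = cl i := fun i hi => update_of_ne hi ..
  refine Ht.seq (walk_spec (G := G) hin₆ hL hd hd1 hcl₆ ?_ ?_ (z := z) (by rw [hlz]; rfl) ?_ ?_ hσ
    hall h19 hst) ?_
  · intro i w hw
    by_cases hi : i = z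
    · rw [hi, hlz, List.mem_singleton] at hw
      rw [hw, hi]
    · rw [hlne i hi] at hw
      exact ((hcand i).mem w hw).2.1
  · intro i
    by_cases hi : i = z
    · rw [hi, hlz]; exact List.nodup_singleton _
    · rw [hlne i hi]; exact (hcand i).nodup
  · intro i hi
    rw [hlne i hi]
    exact (hcand i).length_eq h.inj hd hb (hcard i)
  · intro i
    rw [hs₆.arr 9, hs₅.arr 9, hs₄.arr 9]
    exact (h₃ i).2
  rintro m₇ ⟨I, hI⟩
  have hs17 : Same [6, 7, 8, 9, 10, 11, 12, 13, 14, 15, 16, 17, 18, 19, 20, 21, 22, 23]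
        [3, 5, 6, 7, 8, 9, 10] m₁ m₇ := hs16.mono.trans hI.same
  choose y hy using fun i => (hI.full i).resolve_left (List.not_mem_nil)
  have hyblk : ∀ i, blk (y i) = i := by
    intro i
    have hw := hI.mem i _ (hy i)
    by_cases hi : i = z
    · rw [hi, hlz, List.mem_singleton] at hw
      rw [hi, hw]
    · rw [hlne i hi] at hw
      exact ((hcand i).mem _ hw).2.1
  have hyt : y z = t := by
    have hw := hI.mem z _ (hy z)
    rwa [hlz, List.mem_singleton] at hw
  refine (swapColors_spec (hin₁.of_same hs17) (col := col) (x := x) (y := y) ?_ hx hyblk ?_ ?_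
    ?_).mono le_rfl ?_
  · rw [hI.same.arr 3, hs16.arr 3]; exact hcol₁
  · rw [hI.same.arr 5, hs₆.arr 5, hs₅.arr 5, hs₄.arr 5, hs₃.arr 5]; exact hx₂'
  · intro i
    rw [hI.chosen i, hy i]
    rfl
  · intro i
    rw [hxc, hI.same.reg 6, hs16.reg 6]
    simp [hm₁]
  · rintro m₈ ⟨hs₈, hc₈⟩
    refine ⟨hs17.trans hs₈, _, hc₈, h.exchange hx hxc hyblk hyt ?_ fun i j => ?_⟩
    · intro i hi u hu
      have hw := hI.mem i _ (hy i)
      rw [hlne i hi] at hw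
      have := ((hcand i).mem _ hw).2.2 u
      rw [hyblk] at this
      exact this ((hL _ _).2 hu)
    · exact hI.indep i j _ _ (hy i) (hy j)

end Phase

end RAM

/-! ### The whole program, and existence from halting -/

namespace RAM

open Function

open scoped ENNReal NNReal

section Main

variable {n k b : ℕ} {G : SimpleGraph (Fin n)} {L : Fin n → List (Fin n)} {blk : Fin n → Fin k}

/-- Ranks increase strictly within a block and stay below its size, so they are injective and, by
counting, surjective; properness below 0 is void. -/
theorem isPartialStrong_rank (hcard : ∀ i, (Finset.univ.filter fun v => blk v = i).card = b) :
    IsPartialStrong G blk b 0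
      fun v => (Finset.univ.filter fun u => u < v ∧ blk u = blk v).card := by
  have hlt : ∀ v, (Finset.univ.filter fun u => u < v ∧ blk u = blk v).card < b := by
    intro v
    rw [← hcard (blk v)]
    refine Finset.card_lt_card ((Finset.ssubset_iff_of_subset ?_).2 ⟨v, by simp, by simp⟩)
    intro u hu
    simp only [Finset.mem_filter, Finset.mem_univ, true_and] at hu ⊢
    exact hu.2
  have hmono : ∀ u v, blk u = blk v → u < v →
      (Finset.univ.filter fun w => w < u ∧ blk w = blk u).card <
        (Finset.univ.filter fun w => w < v ∧ blk w = blk v).card := by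
    intro u v hb h
    refine Finset.card_lt_card ((Finset.ssubset_iff_of_subset ?_).2 ⟨u, by simp [h, hb], by simp⟩)
    intro w hw
    simp only [Finset.mem_filter, Finset.mem_univ, true_and] at hw ⊢
    exact ⟨hw.1.trans h, hw.2.trans hb⟩
  have hinj : ∀ u v, blk u = blk v →
      (Finset.univ.filter fun w => w < u ∧ blk w = blk u).card =
        (Finset.univ.filter fun w => w < v ∧ blk w = blk v).card → u = v := by
    intro u v hb hc
    rcases lt_trichotomy u v with h | h | h
    · exact absurd hc (hmono u v hb h).ne
    · exact h
    · exact absurd hc (hmono v u hb.symm h).ne'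
  refine ⟨hlt, hinj, fun i c hc => ?_, fun u v hu => absurd hu (Nat.not_lt_zero _)⟩
  have hsurj := Finset.surjOn_of_injOn_of_card_le
    (s := Finset.univ.filter fun v => blk v = i) (t := Finset.range b)
    (fun v => (Finset.univ.filter fun u => u < v ∧ blk u = blk v).card)
    (fun v _ => by simpa using hlt v)
    (fun u hu v hv h => by
      simp only [Finset.coe_filter, Finset.mem_univ, true_and, Set.mem_ofPred_eq] at hu hv
      exact hinj u v (hu.trans hv.symm) h)
    (by rw [hcard, Finset.card_range])
  obtain ⟨v, hv, hvc⟩ := hsurj (show c ∈ (Finset.range b : Set ℕ) by simpa using hc)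
  simp only [Finset.coe_filter, Finset.mem_univ, true_and, Set.mem_ofPred_eq] at hv
  exact ⟨v, hv, hvc⟩

theorem IsPartialStrong.isStrongColoring {col : Fin n → ℕ} (h : IsPartialStrong G blk b n col) :
    IsStrongColoring G blk fun v => (⟨col v, h.lt v⟩ : Fin b) := by
  refine ⟨fun u v hadj heq => h.proper u v u.2 v.2 hadj (congrArg Fin.val heq), fun i c => ?_⟩
  obtain ⟨v, hv, hvc⟩ := h.surj i c c.2
  exact ⟨v, hv, Fin.ext hvc⟩

theorem IsAdjList.length_eq_degree [DecidableRel G.Adj] (hL : IsAdjList G L) (v : Fin n) :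
    (L v).length = G.degree v := by
  rw [← List.toFinset_card_of_nodup (hL v).1, SimpleGraph.degree]
  congr 1
  ext u
  rw [List.mem_toFinset, (hL v).2, SimpleGraph.mem_neighborFinset]

theorem strongColoring_spec [DecidableRel G.Adj] (hL : IsAdjList G L)
    (hcard : ∀ i, {v | blk v = i}.ncard = b) (hb : 5 * G.maxDegree ≤ b) :
    Ht (inputMemory b L blk) strongColoring (1000 * (max n 1) ^ 2 * (max G.maxDegree 1) ^ 2)
      fun m => ∃ col : Fin n → Fin b, IsStrongColoring G blk col ∧ HoldsColoring m col := by
  set m := inputMemory b L blk with hm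
  set d := G.maxDegree with hd
  have hcard' : ∀ i, (Finset.univ.filter fun v => blk v = i).card = b := by
    intro i
    rw [← hcard i, ← Set.ncard_coe_finset]
    congr 1
    ext v
    simp
  have hnkb : n = k * b := by
    have := Finset.card_eq_sum_card_fiberwise (f := blk) (s := Finset.univ) (t := Finset.univ)
      fun _ _ => by simp
    simpa [hcard'] using this
  have hkn : 5 * d * k ≤ n := by
    rw [hnkb, mul_comm k]
    gcongr
  have hlen : ∀ v, (L v).length ≤ d := by
    intro v
    rw [IsAdjList.length_eq_degree hL]
    exact G.degree_le_maxDegree v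
  have hin : HoldsInput L blk m := holdsInput_inputMemory L blk
  set τ := (n - 0) * ((1 + n * d ^ 2 * 500 + 1) + 1) + 1 with hτ
  refine (Ht.seq (initColors_spec hin rfl) ?_).weaken
    (τ := 1 + (n * 13 + 3) + (1 + (n * (d * 20 + 30) + 10) + (1 + 2 + τ + 2))) ?_
  · rintro m₁ ⟨hs₁, hc₁⟩
    have hin₁ := hin.of_same hs₁
    refine Ht.seq (degreeBound_spec hin₁ hlen) ?_
    rintro m₂ ⟨hs₂, hle, hor⟩
    have hs12 : Same [4, 8, 9, 11, 13, 14, 15] [3, 4] m m₂ := hs₁.mono.trans hs₂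
    have hin₂ := hin.of_same hs12
    have h4 : m₂.reg 4 = 4 * d := by
      refine le_antisymm ?_ ?_
      · rcases hor with h | ⟨v, h⟩
        · rw [h]; exact Nat.zero_le _
        · rw [h]; exact Nat.mul_le_mul_left 4 (hlen v)
      · have : d ≤ m₂.reg 4 / 4 := by
          refine G.maxDegree_le_of_forall_degree_le _ fun v => ?_
          rw [← IsAdjList.length_eq_degree hL, Nat.le_div_iff_mul_le (by norm_num), mul_comm]
          exact hle v
        omega
    have hc₂ : ∀ v : Fin n, m₂.arr 3 v =
        (Finset.univ.filter fun u => u < v ∧ blk u = blk v).card := by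
      rw [hs₂.arr 3]; exact hc₁
    have hpart := isPartialStrong_rank (G := G) hcard'
    set col₀ : Fin n → ℕ := fun v => (Finset.univ.filter fun u => u < v ∧ blk u = blk v).card
    have hfinal : ∀ (m' : Memory) (col : Fin n → ℕ), (∀ v : Fin n, m'.arr 3 v = col v) →
        IsPartialStrong G blk b n col →
        ∃ col : Fin n → Fin b, IsStrongColoring G blk col ∧ HoldsColoring m' col :=
      fun m' col h1 h2 => ⟨_, h2.isStrongColoring, h1⟩
    have hs₃ : Same [5] [] m₂ (m₂.setReg 5 0) := (Same.refl _ _ _).setReg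
    rw [add_comm (1 + 2) τ, add_comm (τ + (1 + 2)), show 2 + (τ + (1 + 2)) = (1 + 2 + τ) + 2 by ring]
    -- If the graph has no edges, the counter jumps to `n` and no phase is run, since the analysis
    -- of the walk requires `1 ≤ d`.
    refine Ht.const_seq (Ht.seq (R := fun m' => m' = m₂.setReg 5 (if d = 0 then n else 0))
      (Ht.ite (τ := 1) (fun h => Ht.skip ?_) fun h => Ht.copy ?_) ?_)
    · simp [h4, hin₂.reg_zero] at h
      rw [if_neg (by omega)]
    · simp [h4, hin₂.reg_zero] at h
      rw [if_pos h]
      simp only [Memory.reg_setReg]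
      norm_num [hin₂.reg_n]
      simp [Memory.setReg]
    · rintro _ rfl
      split_ifs with hd0
      · refine (Ht.loop_exit (by simp [hin₂.reg_n]) (hfinal _ col₀ hc₂
          ⟨hpart.lt, hpart.inj, hpart.surj, fun u v _ _ hadj => ?_⟩)).weaken (by omega)
        have hpos : 0 < G.degree u := (G.degree_pos_iff_exists_adj u).2 ⟨v, hadj⟩
        have := G.degree_le_maxDegree u
        omega
      · refine Ht.loop_count (N := n) (fun j m' => HoldsInput L blk m' ∧ m'.reg 5 = j ∧
          m'.reg 4 = 4 * d ∧ ∃ col : Fin n → ℕ, (∀ v : Fin n, m'.arr 3 v = col v) ∧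
            IsPartialStrong G blk b j col) ?_ ?_ ?_ (Nat.zero_le n) ?_
        · rintro j m' ⟨h1, h2, -⟩
          exact ⟨h2, h1.reg_n⟩
        · rintro j m' hj ⟨h1, h2, h3, col, h5, h6⟩
          refine Ht.seq (phase_spec (t := ⟨j, hj⟩) h1 (fun v => (hL v).2) hlen (by omega) hb hcard'
            hkn h2 h3 h5 h6) ?_
          rintro m'' ⟨hs, col', h7, h8⟩
          refine Ht.incr ⟨?_, ?_, ?_, col', h7, h8⟩
          · exact (h1.of_same hs).of_same (R := [5]) (A := []) (Same.refl _ _ _).setReg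
          · simp [hs.reg 5, h2]
          · simp [hs.reg 4, h3]
        · rintro m' ⟨-, -, -, col, h1, h2⟩
          exact hfinal m' col h1 h2
        · exact ⟨hin₂.of_same hs₃, by simp, by simp [h4], col₀, hc₂, hpart⟩
  · have hN : n ≤ max n 1 := le_max_left _ _
    have hN1 : 1 ≤ max n 1 := le_max_right _ _
    have hD : d ≤ max d 1 := le_max_left _ _
    have hD1 : 1 ≤ max d 1 := le_max_right _ _
    generalize max n 1 = N at hN hN1 ⊢
    generalize max d 1 = D at hD hD1 ⊢
    set S := N ^ 2 * D ^ 2 with hS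
    have hD2 : 1 ≤ D ^ 2 := Nat.one_le_pow _ _ hD1
    have hN2 : 1 ≤ N ^ 2 := Nat.one_le_pow _ _ hN1
    have e1 : 1 ≤ S := Nat.mul_pos hN2 hD2
    have e2 : n * n * d ^ 2 ≤ S := by rw [hS, sq N]; gcongr
    have e3 : n ≤ S := by
      calc n ≤ N := hN
        _ ≤ N ^ 2 := by nlinarith
        _ ≤ S := Nat.le_mul_of_pos_right _ hD2
    have e4 : n * d ≤ S := by
      calc n * d ≤ N * D := by gcongr
        _ ≤ N ^ 2 * D ^ 2 := by gcongr <;> nlinarith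
    have e5 : τ = 500 * (n * n * d ^ 2) + 3 * n + 1 := by rw [hτ, Nat.sub_zero]; ring
    have e6 : n * (d * 20 + 30) = 20 * (n * d) + 30 * n := by ring
    have e7 : 1000 * N ^ 2 * D ^ 2 = 1000 * S := by rw [hS]; ring
    rw [e5, e6, e7]
    omega

theorem strongColoring_correct [DecidableRel G.Adj] (hL : IsAdjList G L)
    (hcard : ∀ i, {v | blk v = i}.ncard = b) (hb : 5 * G.maxDegree ≤ b) :
    (∀ (t : ℕ) (c : Config),
      c ∈ (run strongColoring (inputMemory b L blk) t).support → c.Halted →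
        ∃ col : Fin n → Fin b, IsStrongColoring G blk col ∧ HoldsColoring c.mem col) ∧
    expectedTime strongColoring (inputMemory b L blk) ≤
      ((1000 * (max n 1) ^ 2 * (max G.maxDegree 1) ^ 2 : ℕ) : ℝ≥0∞) := by
  classical
  -- With this terminal cost, a wrong output of positive probability would make the total cost
  -- infinite.
  set g : Memory → ℝ≥0∞ := fun m =>
    if ∃ col : Fin n → Fin b, IsStrongColoring G blk col ∧ HoldsColoring m col then 0 else ⊤ with hg
  have hcost : ∀ T, cost g T ⟨[strongColoring], inputMemory b L blk⟩ ≤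
      ((1000 * (max n 1) ^ 2 * (max G.maxDegree 1) ^ 2 : ℕ) : ℝ≥0∞) := by
    intro T
    refine (strongColoring_spec hL hcard hb g [] 0 T fun m hm => ?_).trans_eq (add_zero _)
    cases T with
    | zero => exact le_rfl
    | succ T => exact (if_pos hm).le
  refine ⟨fun t c hc hh => ?_, expectedTime_le g hcost⟩
  by_contra hno
  have := cost_eq_top_of_mem_support (g := g) hc hh (if_neg hno)
  exact absurd (hcost (t + 1)) (by rw [this]; exact not_le.2 (ENNReal.natCast_lt_top _))

/-- If no reachable configuration were halted, every summand of the expected time would be 1. -/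
theorem exists_halted_of_expectedTime_ne_top {p : Prog} {m : Memory} (h : expectedTime p m ≠ ⊤) :
    ∃ t, ∃ c ∈ (run p m t).support, c.Halted := by
  by_contra! hno
  refine h ?_
  have : ∀ t, (run p m t).toOuterMeasure {c | ¬ c.Halted} = 1 := fun t =>
    (PMF.toOuterMeasure_apply_eq_one_iff _ _).2 fun c hc => hno t c hc
  simp_rw [expectedTime, this]
  exact ENNReal.tsum_const_eq_top_of_ne_zero one_ne_zero

theorem exists_isStrongColoring_fin [DecidableRel G.Adj]
    (hcard : ∀ i, {v | blk v = i}.ncard = b) (hb : 5 * G.maxDegree ≤ b) :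
    ∃ col : Fin n → Fin b, IsStrongColoring G blk col := by
  obtain ⟨h1, h2⟩ := strongColoring_correct (G := G) (L := fun v => (G.neighborFinset v).toList)
    (fun v => ⟨Finset.nodup_toList _, by simp⟩) hcard hb
  obtain ⟨t, c, hc, hh⟩ := exists_halted_of_expectedTime_ne_top
    (h2.trans_lt (ENNReal.natCast_lt_top _)).ne
  obtain ⟨col, hcol, -⟩ := h1 t c hc hh
  exact ⟨col, hcol⟩

theorem exists_isStrongColoring {V ι : Type*} [Fintype V] (G : SimpleGraph V) [DecidableRel G.Adj]
    (blk : V → ι) (b : ℕ) (hcard : ∀ i, {v | blk v = i}.ncard = b) (hb : 5 * G.maxDegree ≤ b) :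
    ∃ col : V → Fin b, IsStrongColoring G blk col := by
  classical
  -- For `b = 0` there may be infinitely many empty blocks, which cannot be numbered; but then there
  -- are neither vertices nor colours.
  rcases Nat.eq_zero_or_pos b with rfl | hpos
  · have hV : IsEmpty V := by
      refine ⟨fun v => ?_⟩
      have h := hcard (blk v)
      rw [Set.ncard_eq_zero] at h
      exact absurd (show v ∈ {w | blk w = blk v} from rfl) (by rw [h]; exact Set.notMem_empty v)
    exact ⟨fun v => hV.elim v, fun v => hV.elim v, fun _ c => c.elim0⟩
  have hsurj : Surjective blk := by
    intro i
    have h : {v | blk v = i}.Nonempty := by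
      rw [← Set.ncard_pos, hcard i]
      exact hpos
    exact h
  have := Fintype.ofSurjective blk hsurj
  set e := Fintype.equivFin V
  set f := Fintype.equivFin ι
  have hcard' : ∀ i, {v | f (blk (e.symm v)) = i}.ncard = b := by
    intro i
    rw [← hcard (f.symm i), ← Set.ncard_image_of_injective _ e.injective]
    congr 1
    ext v
    simp [Equiv.eq_symm_apply]
  obtain ⟨col, h1, h2⟩ := exists_isStrongColoring_fin (G := G.comap e.symm) hcard'
    (by rwa [(SimpleGraph.Iso.comap e.symm G).maxDegree_eq])
  refine ⟨fun v => col (e v), fun u v hadj => h1 _ _ (by simpa using hadj), fun i c => ?_⟩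
  obtain ⟨v, hv, hvc⟩ := h2 (f i) c
  exact ⟨e.symm v, f.injective hv, by simpa using hvc⟩

end Main

end RAM

theorem mainTheorem9 :
    -- existence
    (∀ {V : Type*} {ι : Type*} [Fintype V] (G : SimpleGraph V) [DecidableRel G.Adj]
      (blk : V → ι) (b : ℕ),
      (∀ i, {v | blk v = i}.ncard = b) → 5 * G.maxDegree ≤ b →
        ∃ col : V → Fin b, IsStrongColoring G blk col) ∧
    -- one randomized program finds a strong colouring of every instance in the stated time
    (∃ (prog : RAM.Prog) (C : ℕ), ∀ (n k b : ℕ) (G : SimpleGraph (Fin n)) [DecidableRel G.Adj]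
      (L : Fin n → List (Fin n)) (blk : Fin n → Fin k),
      IsAdjList G L → (∀ i, {v | blk v = i}.ncard = b) → 5 * G.maxDegree ≤ b →
        (∀ (t : ℕ) (c : RAM.Config),
          c ∈ (RAM.run prog (inputMemory b L blk) t).support → c.Halted →
            ∃ col : Fin n → Fin b, IsStrongColoring G blk col ∧ HoldsColoring c.mem col) ∧
        RAM.expectedTime prog (inputMemory b L blk) ≤
          ((C * (max n 1) ^ 2 * (max G.maxDegree 1) ^ 2 : ℕ) : ENNReal)) :=
  ⟨fun G _ blk b hcard hb => RAM.exists_isStrongColoring G blk b hcard hb,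
    RAM.strongColoring, 1000, fun _ _ _ _ _ _ _ hL hcard hb =>
      RAM.strongColoring_correct hL hcard hb⟩
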